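/- Let $n\ge 1$, let $e_1,\dots,e_n$ be the standard basis of $\mathbb R^n$, and let all bodies of revolution have the $e_1$-axis as axis. A symmetric convex body of revolution is a compact convex set $K\subset\mathbb R^n$ with non-empty interior, with $-K=K$, and invariant under all linear isometries of $\mathbb R^n$ fixing $e_1$. Write $\rho_K(u)=\sup\{\lambda\ge 0:\lambda u\in K\}$ for the radial function and $\|\cdot\|_K$ for the Minkowski functional of $K$. The intersection body $IK$ is the star-shaped set with $\rho_{IK}(u)=|K\cap u^\perp|_{n-1}$ for all unit vectors $u$. The modulus of convexity of a body $L$ at the equator is $$\delta^e_L(\varepsilon)=\inf\Big\{1-\Big\|\frac{x+y}{2}\Big\|_L:\ x,y\in L,\ \|x-y\|_L\ge 2\varepsilon,\ x-y\in\operatorname{span}\{e_1\}\Big\}.$$ Put $\psi_L(x)=\rho_L(\theta)\sin\theta$, where $\theta\in(0,\pi)$, $\cot\theta=x$, and $\rho_L(\theta)=\rho_L(\cos\theta\, e_1+\sin\theta\, e_2)$. The body $L$ has equatorial power type $2$ if there are $c,c',r>0$, depending on $L$, with $c<|\psi_L(x)-\psi_L(0)|/x^2<c'$ whenever $0<|x|\le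 r$. A class $\mathcal C$ of bodies of revolution (possibly of different dimensions) has uniform equatorial power type $2$ if each member has equatorial power type $2$ and there are constants $c,c'>0$ with $c<\delta^e_L(\varepsilon)/\varepsilon^2<c'$ for all $L\in\mathcal C$ and all $\varepsilon\in(0,1]$. Theorem. The class of all intersection bodies $IK$ of symmetric convex bodies of revolution $K\subset\mathbb R^n$, $n\ge 4$, has uniform equatorial power type $2$. Moreover, there are absolute constants $c_1,c_2,M>0$ such that for every $n\ge 4$ and every symmetric convex body of revolution $K\subset\mathbb R^n$ there is a constant $c_K\in[c_1,c_2]$ with $$\big|\delta^e_{IK}(\varepsilon)-c_K\,\varepsilon^2\big|\le M\varepsilon^3\qquad\text{for all }\varepsilon\in(0,1].$$ -/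

import Mathlib

open scoped Pointwise

noncomputable section

namespace BodyOfRevolution

/-- Euclidean space `ℝⁿ`. -/
abbrev Euc (n : ℕ) : Type := EuclideanSpace ℝ (Fin n)

/-- The standard basis vector of `ℝⁿ` with (zero-based) index `k`. -/
def coordVec (n k : ℕ) : Euc n :=
  WithLp.toLp 2 (fun i : Fin n => if (i : ℕ) = k then (1 : ℝ) else 0)

/-- The unit vector `e₁` on the axis of revolution. -/
abbrev axisVec (n : ℕ) : Euc n := coordVec n 0

/-- `K` is a symmetric convex body of revolution about the `e₁`-axis: a compact convex set with
nonempty interior, `-K = K`, which is mapped to itself by every linear isometry of `ℝⁿ` that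
fixes the axis pointwise. -/
structure IsSymmConvexBodyOfRevolution {n : ℕ} (K : Set (Euc n)) : Prop where
  isCompact : IsCompact K
  convex : Convex ℝ K
  interior_nonempty : (interior K).Nonempty
  symm : -K = K
  revolution : ∀ g : Euc n ≃ₗᵢ[ℝ] Euc n, g (axisVec n) = axisVec n → g '' K = K

/-- The radial function `ρ_K(u) = sup {t ≥ 0 : t u ∈ K}`. -/
def radialFun {n : ℕ} (K : Set (Euc n)) (u : Euc n) : ℝ :=
  sSup {t : ℝ | 0 ≤ t ∧ t • u ∈ K}

/-- The `(n-1)`-dimensional Lebesgue measure `|K ∩ u^⊥|` of a central hyperplane section.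
The normalized Hausdorff measure restricts to Lebesgue measure on each hyperplane. -/
def sectionVolume {n : ℕ} (K : Set (Euc n)) (u : Euc n) : ℝ :=
  (MeasureTheory.Measure.euclideanHausdorffMeasure (n - 1) : MeasureTheory.Measure (Euc n)).real
    (K ∩ {x : Euc n | inner ℝ u x = 0})

/-- The intersection body `IK`: the star-shaped set whose radial function on the unit sphere is
`u ↦ |K ∩ u^⊥|`. -/
def intersectionBody {n : ℕ} (K : Set (Euc n)) : Set (Euc n) :=
  {x : Euc n | ∃ u : Euc n, ‖u‖ = 1 ∧ ∃ r : ℝ, 0 ≤ r ∧ r ≤ sectionVolume K u ∧ x = r • u}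

/-- The modulus of convexity at the equator:
`inf {1 - ‖(x + y) / 2‖_K : x, y ∈ K, ‖x - y‖_K ≥ 2ε, x - y ∈ span {e₁}}`,
where `‖·‖_K` is the Minkowski functional of `K`. -/
def equatorialModulus {n : ℕ} (K : Set (Euc n)) (ε : ℝ) : ℝ :=
  sInf {d : ℝ | ∃ x ∈ K, ∃ y ∈ K, 2 * ε ≤ gauge K (x - y) ∧
    x - y ∈ Submodule.span ℝ {axisVec n} ∧ d = 1 - gauge K ((1 / 2 : ℝ) • (x + y))}

/-- The radial function of a body of revolution in a direction at angle `θ` from the axis. -/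
def radialAngle {n : ℕ} (K : Set (Euc n)) (θ : ℝ) : ℝ :=
  radialFun K (Real.cos θ • coordVec n 0 + Real.sin θ • coordVec n 1)

/-- `ψ_K(x) = ρ_K(θ) |sin θ|`, where `θ ∈ (0, π)` is the angle with `cot θ = x`. -/
def equatorialProfile {n : ℕ} (K : Set (Euc n)) (x : ℝ) : ℝ :=
  radialAngle K (Real.pi / 2 - Real.arctan x) * |Real.sin (Real.pi / 2 - Real.arctan x)|

/-- Equatorial power type `p`: `|ψ_K(x) - ψ_K(0)|` is comparable to `|x|^p` near the equator,
that is, for `x ≠ 0` close to `0`. -/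
def HasEquatorialPowerType {n : ℕ} (p : ℝ) (K : Set (Euc n)) : Prop :=
  ∃ c₁ c₂ r : ℝ, 0 < c₁ ∧ 0 < c₂ ∧ 0 < r ∧ ∀ x : ℝ, 0 < |x| → |x| ≤ r →
    c₁ < |equatorialProfile K x - equatorialProfile K 0| / |x| ^ p ∧
    |equatorialProfile K x - equatorialProfile K 0| / |x| ^ p < c₂

/-- Uniform equatorial power type `p` of a collection of bodies of revolution, possibly of
different dimensions: every member has equatorial power type `p`, and
`c₁ < δ^e_K(ε) / ε^p < c₂` for all `ε ∈ (0, 1]` with the same constants for all members. -/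
def HasUniformEquatorialPowerType (p : ℝ) (C : Set (Σ n : ℕ, Set (Euc n))) : Prop :=
  (∀ L ∈ C, HasEquatorialPowerType p L.2) ∧
  ∃ c₁ c₂ : ℝ, 0 < c₁ ∧ 0 < c₂ ∧ ∀ L ∈ C, ∀ ε : ℝ, 0 < ε → ε ≤ 1 →
    c₁ < equatorialModulus L.2 ε / ε ^ p ∧ equatorialModulus L.2 ε / ε ^ p < c₂

/-- The class of intersection bodies of symmetric convex bodies of revolution in dimensions
`n ≥ 4`. -/
def intersectionBodyClass : Set (Σ n : ℕ, Set (Euc n)) :=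
  {L | 4 ≤ L.1 ∧ ∃ K : Set (Euc L.1), IsSymmConvexBodyOfRevolution K ∧ L.2 = intersectionBody K}

end BodyOfRevolution

end

/-!
A body of revolution `K` is described by the radius `f` of its sections orthogonal to the axis, an
even concave function on `[-a, a]`. Put `R = f 0`, `g = f / R` and `k = n - 2`. Slicing a central
section by the planes orthogonal to its axial direction shows that, up to a constant, the equatorial
profile of the intersection body at `R x` is `Ψ(x) = ∫₀ᵃ √(g² - x² t²)ᵏ dt`, truncated where the
radicand is negative (`IsSymmConvexBodyOfRevolution.sectionVolume_of_pos`). Accordingly the gauge of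
the intersection body is a perspective of `1 / Ψ`
(`IsSymmConvexBodyOfRevolution.isAxialGauge_intersectionBody`).

The function `1 / Ψ` is convex (`IsProfile.convexOn_inv_profileIntegral`). This is Busemann's theorem
for bodies of revolution, obtained here from Ball's inequality on the half-line: transport the
density of `Ψ(x₀)` monotonically to that of `Ψ(x₁)` and compare with the density at the intermediate
slope along the harmonic mean of the two positions (`harmonic_mean_integral_le`).

Convexity of `1 / Ψ` implies that, among chords parallel to the axis and of given length, the one
whose midpoint is closest to the boundary is centred on the equatorial hyperplane
(`IsAxialGauge.modulus_eq`). Hence `δ(ε) = 1 - Ψ(x) / Ψ(0)`, where `x` is the least solution of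
`x Ψ(x) = ε J` and `J = ∫₀¹ √(1 - s²)ᵏ ds`.

It remains to expand `Ψ` at `0` uniformly in the dimension and in the body. With `V = Ψ(0)` and
`X = √(k / 2) x V` one has `Ψ(x) / V = 1 - q X² + O(X³)`, where
`q = V⁻³ ∫₀ᵃ t² gᵏ⁻²` lies between absolute constants (`IsProfile.exists_expansion`): the lower bound
is a rearrangement inequality, and the upper bound, like that of the remainder, follows from the
decay of powers of a concave function at a rate governed by `V` (`IsProfile.pow_mul_pow_le`). Since
`√(k / 2) J` also lies between absolute constants, `δ(ε) = q (√(k / 2) J)² ε² + O(ε³)`.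
-/

namespace BodyOfRevolution

open MeasureTheory Set Filter Topology

/-! ### Monotone transport and Ball's inequality on the half-line -/

/-- The normalized distribution function of a positive continuous density on `(0, T)`. -/
lemma exists_normalized_primitive {T : ℝ} {S : ℝ → ℝ} (hT : 0 < T)
    (hc : ContinuousOn S (Ioo 0 T)) (hp : ∀ t ∈ Ioo 0 T, 0 < S t)
    (hi : IntervalIntegrable S volume 0 T) :
    0 < ∫ t in (0 : ℝ)..T, S t ∧ ∃ G : ℝ → ℝ, G 0 = 0 ∧ G T = 1 ∧ ContinuousOn G (Icc 0 T) ∧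
      StrictMonoOn G (Icc 0 T) ∧
      ∀ t ∈ Ioo 0 T, HasDerivAt G (S t / ∫ t in (0 : ℝ)..T, S t) t := by
  have hI : 0 < ∫ t in (0 : ℝ)..T, S t :=
    intervalIntegral.intervalIntegral_pos_of_pos_on hi hp hT
  have hderiv : ∀ t ∈ Ioo 0 T, HasDerivAt
      (fun t => (∫ u in (0 : ℝ)..t, S u) / ∫ t in (0 : ℝ)..T, S t)
      (S t / ∫ t in (0 : ℝ)..T, S t) t := by
    intro t ht
    refine (intervalIntegral.integral_hasDerivAt_right ?_ ?_ ?_).div_const _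
    · exact hi.mono_set (by
        rw [uIcc_of_le ht.1.le, uIcc_of_le hT.le]; exact Icc_subset_Icc_right ht.2.le)
    · exact hc.stronglyMeasurableAtFilter isOpen_Ioo t ht
    · exact hc.continuousAt (isOpen_Ioo.mem_nhds ht)
  have hcont : ContinuousOn (fun t => (∫ u in (0 : ℝ)..t, S u) / ∫ t in (0 : ℝ)..T, S t)
      (Icc 0 T) := by
    have h := intervalIntegral.continuousOn_primitive_interval (μ := volume) (a := 0) (b := T)
      (f := S) (by
        rw [uIcc_of_le hT.le]
        exact (intervalIntegrable_iff_integrableOn_Icc_of_le hT.le).1 hi)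
    rw [uIcc_of_le hT.le] at h
    exact h.div_const _
  refine ⟨hI, fun t => (∫ u in (0 : ℝ)..t, S u) / ∫ t in (0 : ℝ)..T, S t, by simp,
    div_self hI.ne', hcont, ?_, hderiv⟩
  refine strictMonoOn_of_deriv_pos (convex_Icc 0 T) hcont fun t ht => ?_
  rw [interior_Icc] at ht
  rw [(hderiv t ht).deriv]
  exact div_pos (hp t ht) hI

/-- Monotone transport of one positive continuous density on an interval to another. -/
lemma exists_monotone_transport {T₀ T₁ : ℝ} {S₀ S₁ : ℝ → ℝ} (hT₀ : 0 < T₀) (hT₁ : 0 < T₁)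
    (hc₀ : ContinuousOn S₀ (Ioo 0 T₀)) (hp₀ : ∀ t ∈ Ioo 0 T₀, 0 < S₀ t)
    (hi₀ : IntervalIntegrable S₀ volume 0 T₀)
    (hc₁ : ContinuousOn S₁ (Ioo 0 T₁)) (hp₁ : ∀ t ∈ Ioo 0 T₁, 0 < S₁ t)
    (hi₁ : IntervalIntegrable S₁ volume 0 T₁) :
    ∃ τ : ℝ → ℝ, StrictMonoOn τ (Ioo 0 T₀) ∧ MapsTo τ (Ioo 0 T₀) (Ioo 0 T₁) ∧
      ∀ s ∈ Ioo 0 T₀, HasDerivAt τ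
        ((S₀ s / ∫ t in (0 : ℝ)..T₀, S₀ t) / (S₁ (τ s) / ∫ t in (0 : ℝ)..T₁, S₁ t)) s := by
  obtain ⟨hI₀, G₀, h00, h0T, hG₀c, hG₀m, hG₀d⟩ := exists_normalized_primitive hT₀ hc₀ hp₀ hi₀
  obtain ⟨hI₁, G₁, h10, h1T, hG₁c, hG₁m, hG₁d⟩ := exists_normalized_primitive hT₁ hc₁ hp₁ hi₁
  have hr₀ : ∀ s ∈ Ioo 0 T₀, G₀ s ∈ Ioo 0 1 := fun s hs =>
    ⟨h00 ▸ hG₀m (left_mem_Icc.2 hT₀.le) (Ioo_subset_Icc_self hs) hs.1,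
      h0T ▸ hG₀m (Ioo_subset_Icc_self hs) (right_mem_Icc.2 hT₀.le) hs.2⟩
  have hr₁ : ∀ s ∈ Ioo 0 T₁, G₁ s ∈ Ioo 0 1 := fun s hs =>
    ⟨h10 ▸ hG₁m (left_mem_Icc.2 hT₁.le) (Ioo_subset_Icc_self hs) hs.1,
      h1T ▸ hG₁m (Ioo_subset_Icc_self hs) (right_mem_Icc.2 hT₁.le) hs.2⟩
  have hex : ∀ y, ∃ t, y ∈ Ioo (0 : ℝ) 1 → t ∈ Ioo 0 T₁ ∧ G₁ t = y := by
    intro y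
    by_cases hy : y ∈ Ioo (0 : ℝ) 1
    · have := intermediate_value_Ioo hT₁.le hG₁c
      rw [h10, h1T] at this
      obtain ⟨t, ht, h⟩ := this hy
      exact ⟨t, fun _ => ⟨ht, h⟩⟩
    · exact ⟨0, fun h => absurd h hy⟩
  -- `σ` inverts `G₁`, and the transport is `σ ∘ G₀`.
  choose σ hσ using hex
  have hσm : StrictMonoOn σ (Ioo 0 1) := by
    intro y hy z hz hyz
    refine (hG₁m.lt_iff_lt (Ioo_subset_Icc_self (hσ y hy).1)
      (Ioo_subset_Icc_self (hσ z hz).1)).1 ?_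
    rwa [(hσ y hy).2, (hσ z hz).2]
  have hσim : Ioo 0 T₁ ⊆ σ '' Ioo 0 1 := fun t ht => ⟨G₁ t, hr₁ t ht,
    hG₁m.injOn (Ioo_subset_Icc_self (hσ _ (hr₁ t ht)).1) (Ioo_subset_Icc_self ht)
      (hσ _ (hr₁ t ht)).2⟩
  refine ⟨σ ∘ G₀, fun s hs t ht hst => hσm (hr₀ s hs) (hr₀ t ht)
    (hG₀m (Ioo_subset_Icc_self hs) (Ioo_subset_Icc_self ht) hst),
    fun s hs => (hσ _ (hr₀ s hs)).1, fun s hs => ?_⟩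
  have hmem := (hσ _ (hr₀ s hs)).1
  have hσc : ContinuousAt σ (G₀ s) :=
    continuousAt_of_monotoneOn_of_image_mem_nhds hσm.monotoneOn (isOpen_Ioo.mem_nhds (hr₀ s hs))
      (mem_of_superset (isOpen_Ioo.mem_nhds hmem) hσim)
  have hσd : HasDerivAt σ (S₁ (σ (G₀ s)) / ∫ t in (0 : ℝ)..T₁, S₁ t)⁻¹ (G₀ s) := by
    refine HasDerivAt.of_local_left_inverse hσc (hG₁d _ hmem) (div_pos (hp₁ _ hmem) hI₁).ne' ?_
    filter_upwards [isOpen_Ioo.mem_nhds (hr₀ s hs)] with y hy using (hσ y hy).2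
  refine (hσd.comp s (hG₀d s hs)).congr_deriv ?_
  rw [Function.comp_apply, div_eq_mul_inv _ (S₁ _ / _), mul_comm]

/-- The pointwise inequality behind Ball's inequality: three applications of the weighted
AM-GM inequality. -/
lemma harmonic_mean_le_of_log_concave {l₀ l₁ I₀ I₁ s t p₀ p₁ p z : ℝ} (hl₀ : 0 < l₀)
    (hl₁ : 0 < l₁) (hI₀ : 0 < I₀) (hI₁ : 0 < I₁) (hs : 0 < s) (ht : 0 < t)
    (hp₀ : 0 < p₀) (hp₁ : 0 < p₁) (hz : z = (l₀ / s + l₁ / t)⁻¹)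
    (hp : p₀ ^ (l₀ * z / s) * p₁ ^ (l₁ * z / t) ≤ p) :
    (l₀ / I₀ + l₁ / I₁)⁻¹ * (p₀ / I₀) ≤
      p * (z ^ 2 * (l₀ / s ^ 2 + l₁ * ((p₀ / I₀) / (p₁ / I₁)) / t ^ 2)) := by
  have hd : 0 < l₀ / s + l₁ / t := by positivity
  have hz0 : 0 < z := by rw [hz]; positivity
  set α := l₀ * z / s with hα
  set β := l₁ * z / t with hβ
  have hα0 : 0 < α := by positivity
  have hβ0 : 0 < β := by positivity
  have hαβ : α + β = 1 := by
    have : α + β = z * (l₀ / s + l₁ / t) := by rw [hα, hβ]; ring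
    rw [this, hz, inv_mul_cancel₀ hd.ne']
  set A := α * I₀ / l₀ with hA
  set B := β * I₁ / l₁ with hB
  have hA0 : 0 < A := by positivity
  have hB0 : 0 < B := by positivity
  have h1 : (A / p₀) ^ α * (B / p₁) ^ β ≤ α * (A / p₀) + β * (B / p₁) :=
    Real.geom_mean_le_arith_mean2_weighted hα0.le hβ0.le (by positivity) (by positivity) hαβ
  have h2 : (A⁻¹) ^ α * (B⁻¹) ^ β ≤ α * A⁻¹ + β * B⁻¹ :=
    Real.geom_mean_le_arith_mean2_weighted hα0.le hβ0.le (by positivity) (by positivity) hαβ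
  have h3 : α * A⁻¹ + β * B⁻¹ = l₀ / I₀ + l₁ / I₁ := by
    rw [hA, hB]; field_simp
  rw [h3, Real.inv_rpow hA0.le, Real.inv_rpow hB0.le, ← mul_inv] at h2
  have h4 : (l₀ / I₀ + l₁ / I₁)⁻¹ ≤ A ^ α * B ^ β := by
    rw [inv_le_comm₀ (by positivity) (by positivity)]; exact h2
  have h5 : z ^ 2 * (l₀ / s ^ 2 + l₁ * ((p₀ / I₀) / (p₁ / I₁)) / t ^ 2) =
      p₀ / I₀ * (α * (A / p₀) + β * (B / p₁)) := by
    rw [hA, hB, hα, hβ]; field_simp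
  rw [h5]
  rw [Real.div_rpow hA0.le hp₀.le, Real.div_rpow hB0.le hp₁.le] at h1
  have hq0 : 0 < p₀ ^ α := by positivity
  have hq1 : 0 < p₁ ^ β := by positivity
  have hp_pos : 0 ≤ p := (mul_pos hq0 hq1).le.trans hp
  calc (l₀ / I₀ + l₁ / I₁)⁻¹ * (p₀ / I₀) ≤ (A ^ α * B ^ β) * (p₀ / I₀) := by gcongr
    _ = (p₀ ^ α * p₁ ^ β) * (p₀ / I₀ * (A ^ α / p₀ ^ α * (B ^ β / p₁ ^ β))) := by field_simp
    _ ≤ p * (p₀ / I₀ * (α * (A / p₀) + β * (B / p₁))) := by gcongr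

/-- Ball's inequality in one dimension: if `S` dominates the geometric means of `S₀` and `S₁`
along harmonic means of the arguments, then `∫ S` dominates the harmonic mean of the
integrals. -/
lemma harmonic_mean_integral_le {a T₀ T₁ l₀ l₁ : ℝ} {S S₀ S₁ : ℝ → ℝ} (hl₀ : 0 < l₀)
    (hl₁ : 0 < l₁) (hl : l₀ + l₁ = 1) (hT₀ : 0 < T₀) (hT₁ : 0 < T₁) (hT₀a : T₀ ≤ a) (hT₁a : T₁ ≤ a)
    (hc₀ : ContinuousOn S₀ (Ioo 0 T₀)) (hp₀ : ∀ t ∈ Ioo 0 T₀, 0 < S₀ t)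
    (hi₀ : IntervalIntegrable S₀ volume 0 T₀)
    (hc₁ : ContinuousOn S₁ (Ioo 0 T₁)) (hp₁ : ∀ t ∈ Ioo 0 T₁, 0 < S₁ t)
    (hi₁ : IntervalIntegrable S₁ volume 0 T₁)
    (hi : IntervalIntegrable S volume 0 a) (hS : ∀ t, 0 ≤ S t)
    (key : ∀ s ∈ Ioo 0 T₀, ∀ t ∈ Ioo 0 T₁, ∀ z, z = (l₀ / s + l₁ / t)⁻¹ →
      S₀ s ^ (l₀ * z / s) * S₁ t ^ (l₁ * z / t) ≤ S z) :
    (l₀ / (∫ t in (0 : ℝ)..T₀, S₀ t) + l₁ / (∫ t in (0 : ℝ)..T₁, S₁ t))⁻¹ ≤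
      ∫ t in (0 : ℝ)..a, S t := by
  obtain ⟨τ, hτm, hτmaps, hτd⟩ := exists_monotone_transport hT₀ hT₁ hc₀ hp₀ hi₀ hc₁ hp₁ hi₁
  set I₀ := ∫ t in (0 : ℝ)..T₀, S₀ t with hI₀d
  set I₁ := ∫ t in (0 : ℝ)..T₁, S₁ t with hI₁d
  have hI₀ : 0 < I₀ := intervalIntegral.intervalIntegral_pos_of_pos_on hi₀ hp₀ hT₀
  have hI₁ : 0 < I₁ := intervalIntegral.intervalIntegral_pos_of_pos_on hi₁ hp₁ hT₁
  have ha : 0 < a := hT₀.trans_le hT₀a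
  set H := (l₀ / I₀ + l₁ / I₁)⁻¹ with hH
  have hH0 : 0 < H := by positivity
  -- `Z` is the weighted harmonic mean of a point and its image under the transport.
  set Z : ℝ → ℝ := fun s => (l₀ / s + l₁ / τ s)⁻¹ with hZ
  set Z' : ℝ → ℝ := fun s =>
    Z s ^ 2 * (l₀ / s ^ 2 + l₁ * ((S₀ s / I₀) / (S₁ (τ s) / I₁)) / τ s ^ 2) with hZ'
  have hZd : ∀ s ∈ Ioo 0 T₀, HasDerivAt Z (Z' s) s := by
    intro s hs
    have hs0 : s ≠ 0 := hs.1.ne'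
    have ht0 : 0 < τ s := (hτmaps hs).1
    have hne : l₀ / s + l₁ / τ s ≠ 0 := by
      have := hs.1
      positivity
    have h := ((((hasDerivAt_id s).inv hs0).const_mul l₀).add
      (((hτd s hs).inv ht0.ne').const_mul l₁)).inv (by simpa [div_eq_mul_inv] using hne)
    refine (h.congr_of_eventuallyEq (Eventually.of_forall fun u => ?_)).congr_deriv ?_
    · simp [hZ, div_eq_mul_inv]
    · simp only [hZ', hZ, id, Pi.add_apply, Pi.inv_apply, div_eq_mul_inv]
      simp only [inv_pow]
      ring
  have hZmono : StrictMonoOn Z (Ioo 0 T₀) := by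
    intro s hs t ht hst
    have h1 := (hτmaps hs).1
    have h2 := hτm hs ht hst
    have h3 := hs.1
    have h4 := ht.1
    have h5 := (hτmaps ht).1
    simp only [hZ]
    gcongr
  have hZmaps : MapsTo Z (Ioo 0 T₀) (Ioc 0 a) := by
    intro s hs
    have h1 := (hτmaps hs).1
    have h2 := (hτmaps hs).2
    have h3 := hs.1
    have h4 := hs.2
    refine ⟨by simp only [hZ]; positivity, ?_⟩
    simp only [hZ]
    rw [inv_le_comm₀ (by positivity) ha]
    calc a⁻¹ = l₀ / a + l₁ / a := by rw [← add_div, hl, one_div]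
      _ ≤ l₀ / s + l₁ / τ s := by
        gcongr
        · exact h4.le.trans hT₀a
        · exact h2.le.trans hT₁a
  -- The substitution `t = Z s` turns the pointwise bound into one for the integrals.
  have hpt : ∀ s ∈ Ioo 0 T₀, H * (S₀ s / I₀) ≤ |Z' s| * S (Z s) := by
    intro s hs
    have h1 := (hτmaps hs).1
    have h := harmonic_mean_le_of_log_concave hl₀ hl₁ hI₀ hI₁ hs.1 h1 (hp₀ s hs)
      (hp₁ _ (hτmaps hs)) rfl (key s hs (τ s) (hτmaps hs) (Z s) rfl)
    calc H * (S₀ s / I₀) ≤ S (Z s) * Z' s := h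
      _ ≤ S (Z s) * |Z' s| := mul_le_mul_of_nonneg_left (le_abs_self _) (hS _)
      _ = _ := mul_comm _ _
  have hlint : ENNReal.ofReal H ≤ ENNReal.ofReal (∫ t in (0 : ℝ)..a, S t) := by
    have h0 : IntegrableOn S₀ (Ioo 0 T₀) :=
      (intervalIntegrable_iff_integrableOn_Ioo_of_le hT₀.le).1 hi₀
    have hS0 : IntegrableOn S (Ioc 0 a) :=
      (intervalIntegrable_iff_integrableOn_Ioc_of_le ha.le).1 hi
    have h1 : ∫ t in Ioo 0 T₀, H * (S₀ t / I₀) = H := by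
      rw [integral_const_mul, integral_div, ← integral_Ioc_eq_integral_Ioo,
        ← intervalIntegral.integral_of_le hT₀.le, ← hI₀d, div_self hI₀.ne', mul_one]
    rw [intervalIntegral.integral_of_le ha.le,
      ofReal_integral_eq_lintegral_ofReal hS0 (ae_of_all _ hS), ← h1,
      ofReal_integral_eq_lintegral_ofReal ((h0.div_const _).const_mul _)
        ((ae_restrict_iff' measurableSet_Ioo).2 (ae_of_all _ fun t ht =>
          mul_nonneg hH0.le (div_nonneg (hp₀ t ht).le hI₀.le)))]
    calc ∫⁻ t in Ioo 0 T₀, ENNReal.ofReal (H * (S₀ t / I₀))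
        ≤ ∫⁻ t in Ioo 0 T₀, ENNReal.ofReal |Z' t| * ENNReal.ofReal (S (Z t)) := by
          refine setLIntegral_mono' measurableSet_Ioo fun t ht => ?_
          rw [← ENNReal.ofReal_mul (abs_nonneg _)]
          exact ENNReal.ofReal_le_ofReal (hpt t ht)
      _ = ∫⁻ t in Z '' Ioo 0 T₀, ENNReal.ofReal (S t) :=
          (lintegral_image_eq_lintegral_abs_deriv_mul measurableSet_Ioo
            (fun t ht => (hZd t ht).hasDerivWithinAt) hZmono.injOn fun t => ENNReal.ofReal (S t)).symm
      _ ≤ ∫⁻ t in Ioc 0 a, ENNReal.ofReal (S t) :=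
          lintegral_mono_set hZmaps.image_subset
  exact (ENNReal.ofReal_le_ofReal_iff
    (intervalIntegral.integral_nonneg ha.le fun t _ => hS t)).1 hlint

/-! ### Normalized profiles and their section integrals -/

/-- A normalized profile of a symmetric convex body of revolution: the radius `g` of the section at
height `t ∈ [0, a]`, scaled so that `g 0 = 1`. -/
structure IsProfile (a : ℝ) (g : ℝ → ℝ) : Prop where
  pos : 0 < a
  concaveOn : ConcaveOn ℝ (Icc 0 a) g
  map_zero : g 0 = 1
  nonneg : ∀ t ∈ Icc 0 a, 0 ≤ g t
  antitoneOn : AntitoneOn g (Icc 0 a)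

/-- The central section, by a hyperplane whose normal has cotangent `x` with the axis, of the body
with profile `g`: twice this integral, times the volume of the `k`-dimensional unit ball, is the
volume of the section times the sine of the angle between the normal and the axis. For negative
radicands `Real.sqrt` is `0`, which is the truncation needed here. -/
noncomputable def profileIntegral (a : ℝ) (g : ℝ → ℝ) (k : ℕ) (x : ℝ) : ℝ :=
  ∫ t in (0 : ℝ)..a, √(g t ^ 2 - x ^ 2 * t ^ 2) ^ k

namespace IsProfile

variable {a : ℝ} {g : ℝ → ℝ} {k : ℕ} (hg : IsProfile a g)

include hg

lemma antitoneOn_sqrt_pow (x : ℝ) :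
    AntitoneOn (fun t => √(g t ^ 2 - x ^ 2 * t ^ 2) ^ k) (Icc 0 a) := by
  intro s hs t ht hst
  have h1 := hg.antitoneOn hs ht hst
  have h2 := hg.nonneg t ht
  have h3 := hs.1
  dsimp only
  gcongr

lemma intervalIntegrable (x : ℝ) :
    IntervalIntegrable (fun t => √(g t ^ 2 - x ^ 2 * t ^ 2) ^ k) volume 0 a := by
  refine AntitoneOn.intervalIntegrable ?_
  rw [uIcc_of_le hg.pos.le]
  exact hg.antitoneOn_sqrt_pow x

lemma le_one {t : ℝ} (ht : t ∈ Icc 0 a) : g t ≤ 1 :=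
  hg.map_zero ▸ hg.antitoneOn (left_mem_Icc.2 hg.pos.le) ht ht.1

lemma continuousOn_Ioo : ContinuousOn g (Ioo 0 a) := by
  have := hg.concaveOn.continuousOn_interior
  rwa [interior_Icc] at this

lemma one_sub_div_le {t : ℝ} (ht : t ∈ Icc 0 a) : 1 - t / a ≤ g t := by
  have ha := hg.pos
  have h := hg.concaveOn.2 (left_mem_Icc.2 ha.le) (right_mem_Icc.2 ha.le)
    (show (0 : ℝ) ≤ 1 - t / a by rw [sub_nonneg, div_le_one ha]; exact ht.2)
    (div_nonneg ht.1 ha.le) (by ring)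
  simp only [smul_eq_mul, mul_zero, zero_add, hg.map_zero, mul_one,
    div_mul_cancel₀ _ ha.ne'] at h
  have := mul_nonneg (div_nonneg ht.1 ha.le) (hg.nonneg a (right_mem_Icc.2 ha.le))
  linarith

/-- The integrand of `profileIntegral` lives on an interval `(0, T)`, on which it is positive and
continuous. -/
lemma exists_support (hk : k ≠ 0) (x : ℝ) : ∃ T, 0 < T ∧ T ≤ a ∧
    (∀ t ∈ Ioo 0 T, |x| * t < g t) ∧
    ContinuousOn (fun t => √(g t ^ 2 - x ^ 2 * t ^ 2) ^ k) (Ioo 0 T) ∧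
    (∀ t ∈ Ioo 0 T, 0 < √(g t ^ 2 - x ^ 2 * t ^ 2) ^ k) ∧
    IntervalIntegrable (fun t => √(g t ^ 2 - x ^ 2 * t ^ 2) ^ k) volume 0 T ∧
    ∫ t in (0 : ℝ)..T, √(g t ^ 2 - x ^ 2 * t ^ 2) ^ k = profileIntegral a g k x := by
  have ha := hg.pos
  set A : Set ℝ := {t | t ∈ Icc 0 a ∧ |x| * t < g t} with hA
  have hbdd : BddAbove A := ⟨a, fun t ht => ht.1.2⟩
  have h0 : (0 : ℝ) ∈ A := ⟨left_mem_Icc.2 ha.le, by simp [hg.map_zero]⟩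
  have hTa : sSup A ≤ a := csSup_le ⟨0, h0⟩ fun t ht => ht.1.2
  have hT : 0 < sSup A := by
    have hpos : 0 < |x| + 1 / a + 1 := by positivity
    set t := min a (1 / (|x| + 1 / a + 1)) with ht
    have ht0 : 0 < t := lt_min ha (by positivity)
    refine ht0.trans_le (le_csSup hbdd ⟨⟨ht0.le, min_le_left _ _⟩, ?_⟩)
    refine lt_of_lt_of_le ?_ (hg.one_sub_div_le ⟨ht0.le, min_le_left _ _⟩)
    have h1 : t * (|x| + 1 / a + 1) ≤ 1 := by
      rw [← le_div_iff₀ hpos]; exact min_le_right _ _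
    have : t / a = t * (1 / a) := by ring
    nlinarith
  have hlt : ∀ t ∈ Ioo 0 (sSup A), |x| * t < g t := by
    intro t ht
    obtain ⟨s, hs, hts⟩ := exists_lt_of_lt_csSup ⟨0, h0⟩ ht.2
    calc |x| * t ≤ |x| * s := by gcongr
      _ < g s := hs.2
      _ ≤ g t := hg.antitoneOn ⟨ht.1.le, hts.le.trans hs.1.2⟩ hs.1 hts.le
  have hint := hg.intervalIntegrable (k := k) x
  have hint1 : IntervalIntegrable (fun t => √(g t ^ 2 - x ^ 2 * t ^ 2) ^ k) volume 0 (sSup A) :=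
    hint.mono_set (by
      rw [uIcc_of_le hT.le, uIcc_of_le ha.le]; exact Icc_subset_Icc_right hTa)
  have hint2 : IntervalIntegrable (fun t => √(g t ^ 2 - x ^ 2 * t ^ 2) ^ k) volume (sSup A) a :=
    hint.mono_set (by
      rw [uIcc_of_le hTa, uIcc_of_le ha.le]; exact Icc_subset_Icc_left hT.le)
  refine ⟨sSup A, hT, hTa, hlt, ?_, ?_, hint1, ?_⟩
  · refine ContinuousOn.pow (ContinuousOn.sqrt (ContinuousOn.sub (ContinuousOn.pow ?_ 2) ?_)) k
    · exact hg.continuousOn_Ioo.mono (Ioo_subset_Ioo_right hTa)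
    · fun_prop
  · intro t ht
    have h1 := hlt t ht
    have h2 : 0 ≤ |x| * t := mul_nonneg (abs_nonneg _) ht.1.le
    refine pow_pos (Real.sqrt_pos.2 ?_) k
    rw [← mul_pow, sub_pos, ← sq_abs (x * t), abs_mul, abs_of_pos ht.1]
    gcongr
  · rw [profileIntegral, ← intervalIntegral.integral_add_adjacent_intervals hint1 hint2,
      left_eq_add]
    rw [intervalIntegral.integral_of_le hTa]
    refine setIntegral_eq_zero_of_forall_eq_zero fun t ht => ?_
    have ht0 : t ∈ Icc 0 a := ⟨hT.le.trans ht.1.le, ht.2⟩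
    have h1 : g t ≤ |x| * t := by
      by_contra! h
      exact absurd (le_csSup hbdd ⟨ht0, h⟩) (not_le.2 ht.1)
    have h2 := hg.nonneg t ht0
    rw [Real.sqrt_eq_zero_of_nonpos, zero_pow hk]
    rw [← mul_pow, sub_nonpos, ← sq_abs (x * t), abs_mul, abs_of_nonneg ht0.1]
    gcongr

lemma profileIntegral_pos (hk : k ≠ 0) (x : ℝ) : 0 < profileIntegral a g k x := by
  obtain ⟨T, hT, -, -, -, hp, hi, h⟩ := hg.exists_support hk x
  rw [← h]
  exact intervalIntegral.intervalIntegral_pos_of_pos_on hi hp hT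

omit hg in
lemma sqrt_pow_rpow_mul {A B α β : ℝ} (hA : 0 ≤ A) (hB : 0 ≤ B) (k : ℕ) :
    (√A ^ k) ^ α * (√B ^ k) ^ β = √(A ^ α * B ^ β) ^ k := by
  have h : ∀ C γ : ℝ, 0 ≤ C → (√C ^ k) ^ γ = √(C ^ γ) ^ k := by
    intro C γ hC
    rw [Real.sqrt_eq_rpow, Real.sqrt_eq_rpow, ← Real.rpow_natCast, ← Real.rpow_natCast,
      ← Real.rpow_mul hC, ← Real.rpow_mul hC, ← Real.rpow_mul hC, ← Real.rpow_mul hC]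
    ring_nf
  rw [h A α hA, h B β hB, ← mul_pow, Real.sqrt_mul (by positivity)]

/-- The special case of Busemann's theorem for bodies of revolution. -/
theorem convexOn_inv_profileIntegral (hk : k ≠ 0) :
    ConvexOn ℝ univ fun x => (profileIntegral a g k x)⁻¹ := by
  refine LinearOrder.convexOn_of_lt convex_univ ?_
  intro x₀ _ x₁ _ _ l₀ l₁ hl₀ hl₁ hl
  simp only [smul_eq_mul]
  obtain ⟨T₀, hT₀, hT₀a, hlt₀, hc₀, hp₀, hi₀, h₀⟩ := hg.exists_support hk x₀
  obtain ⟨T₁, hT₁, hT₁a, hlt₁, hc₁, hp₁, hi₁, h₁⟩ := hg.exists_support hk x₁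
  have hpos := hg.profileIntegral_pos hk (l₀ * x₀ + l₁ * x₁)
  have hpos₀ := hg.profileIntegral_pos hk x₀
  have hpos₁ := hg.profileIntegral_pos hk x₁
  rw [inv_le_comm₀ hpos (by positivity), ← div_eq_mul_inv, ← div_eq_mul_inv, ← h₀, ← h₁]
  refine harmonic_mean_integral_le hl₀ hl₁ hl hT₀ hT₁ hT₀a hT₁a hc₀ hp₀ hi₀ hc₁ hp₁ hi₁
    (hg.intervalIntegrable _) (fun t => by positivity) ?_
  intro s hs t ht z hz
  have hs0 := hs.1
  have ht0 := ht.1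
  have hd : 0 < l₀ / s + l₁ / t := by positivity
  have hz0 : 0 < z := by rw [hz]; positivity
  set α := l₀ * z / s with hα
  set β := l₁ * z / t with hβ
  have hα0 : 0 < α := by positivity
  have hβ0 : 0 < β := by positivity
  have hαβ : α + β = 1 := by
    have : α + β = z * (l₀ / s + l₁ / t) := by rw [hα, hβ]; ring
    rw [this, hz, inv_mul_cancel₀ hd.ne']
  have hαs : α * s = l₀ * z := by rw [hα]; field_simp
  have hβt : β * t = l₁ * z := by rw [hβ]; field_simp
  have hzst : z = α * s + β * t := by rw [hαs, hβt, ← add_mul, hl, one_mul]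
  have hconc : α * g s + β * g t ≤ g z := by
    have := hg.concaveOn.2 ⟨hs0.le, hs.2.le.trans hT₀a⟩ ⟨ht0.le, ht.2.le.trans hT₁a⟩
      hα0.le hβ0.le hαβ
    rw [hzst]
    simpa using this
  have hs1 := hlt₀ s hs
  have ht1 := hlt₁ t ht
  have hs2 : |x₀ * s| < g s := by rwa [abs_mul, abs_of_pos hs0]
  have ht2 : |x₁ * t| < g t := by rwa [abs_mul, abs_of_pos ht0]
  rw [abs_lt] at hs2 ht2
  have hxz : (l₀ * x₀ + l₁ * x₁) * z = α * (x₀ * s) + β * (x₁ * t) := by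
    linear_combination (-x₀) * hαs - x₁ * hβt
  have hu0 : 0 ≤ g s - x₀ * s := by linarith
  have hv0 : 0 ≤ g s + x₀ * s := by linarith
  have hu1 : 0 ≤ g t - x₁ * t := by linarith
  have hv1 : 0 ≤ g t + x₁ * t := by linarith
  -- Both factors of `g² - x² t² = (g - x t) (g + x t)` are concave along the interpolation, hence
  -- dominate the geometric means of their values at the ends.
  have hu : (g s - x₀ * s) ^ α * (g t - x₁ * t) ^ β ≤ g z - (l₀ * x₀ + l₁ * x₁) * z :=
    (Real.geom_mean_le_arith_mean2_weighted hα0.le hβ0.le hu0 hu1 hαβ).trans (by linarith)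
  have hv : (g s + x₀ * s) ^ α * (g t + x₁ * t) ^ β ≤ g z + (l₀ * x₀ + l₁ * x₁) * z :=
    (Real.geom_mean_le_arith_mean2_weighted hα0.le hβ0.le hv0 hv1 hαβ).trans (by linarith)
  have e0 : g s ^ 2 - x₀ ^ 2 * s ^ 2 = (g s - x₀ * s) * (g s + x₀ * s) := by ring
  have e1 : g t ^ 2 - x₁ ^ 2 * t ^ 2 = (g t - x₁ * t) * (g t + x₁ * t) := by ring
  have e : g z ^ 2 - (l₀ * x₀ + l₁ * x₁) ^ 2 * z ^ 2 =
    (g z - (l₀ * x₀ + l₁ * x₁) * z) * (g z + (l₀ * x₀ + l₁ * x₁) * z) := by ring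
  rw [e0, e1, e, sqrt_pow_rpow_mul (mul_nonneg hu0 hv0) (mul_nonneg hu1 hv1),
    Real.mul_rpow hu0 hv0, Real.mul_rpow hu1 hv1, mul_mul_mul_comm]
  gcongr
  exact (by positivity : (0 : ℝ) ≤ _).trans hu

end IsProfile

/-! ### Uniform expansion of the section integral at the equator -/

lemma exp_neg_sq_le {w : ℝ} (hw : 0 ≤ w) : Real.exp (-w ^ 2) ≤ 1 - w ^ 2 + w ^ 3 := by
  rcases le_total 1 w with h | h
  · have : Real.exp (-w ^ 2) ≤ 1 := Real.exp_le_one_iff.2 (by nlinarith [sq_nonneg w])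
    nlinarith [sq_nonneg w, mul_nonneg (sq_nonneg w) (sub_nonneg.2 h)]
  · have h1 := Real.quadratic_le_exp_of_nonneg (sq_nonneg w)
    have h2 : Real.exp (-w ^ 2) ≤ 1 - w ^ 2 + (w ^ 2) ^ 2 / 2 := by
      rw [Real.exp_neg, inv_le_comm₀ (Real.exp_pos _) (by nlinarith [sq_nonneg (w ^ 2 - 1)])]
      refine le_trans ?_ h1
      rw [inv_le_iff_one_le_mul₀ (by nlinarith [sq_nonneg (w ^ 2 - 1)])]
      nlinarith [sq_nonneg (w ^ 2), sq_nonneg ((w ^ 2) ^ 2)]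
    have h3 : w ^ 4 ≤ w ^ 3 := pow_le_pow_of_le_one hw h (by norm_num)
    have h4 : 0 ≤ w ^ 3 := by positivity
    nlinarith

/-- Bernoulli's inequality, also valid where the radicand is negative. -/
lemma sqrt_sub_pow_ge {k : ℕ} (hk : 2 ≤ k) {c y : ℝ} (hc : 0 ≤ c) (hy : 0 ≤ y) :
    c ^ k - k / 2 * y * c ^ (k - 2) ≤ √(c ^ 2 - y) ^ k := by
  have hk' : (2 : ℝ) ≤ k := by exact_mod_cast hk
  have hck : c ^ k = c ^ 2 * c ^ (k - 2) := by rw [← pow_add]; congr 1; omega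
  rcases le_total (c ^ 2) y with h | h
  · have h1 : c ^ k - k / 2 * y * c ^ (k - 2) ≤ 0 := by
      have : c ^ 2 ≤ k / 2 * y := by nlinarith
      have := mul_le_mul_of_nonneg_right this (pow_nonneg hc (k - 2))
      rw [hck]; linarith
    exact h1.trans (by positivity)
  · rcases hc.eq_or_lt with rfl | hc
    · have : y = 0 := le_antisymm (by simpa using h) hy
      subst this
      simp
    · set u := y / c ^ 2 with hu
      have hyu : y = c ^ 2 * u := by rw [hu]; field_simp
      have hu1 : u ≤ 1 := by rw [hu, div_le_one (by positivity)]; exact h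
      have h1 : 1 + (k / 2 : ℝ) * (-u) ≤ (1 + -u) ^ (k / 2 : ℝ) :=
        one_add_mul_self_le_rpow_one_add (by linarith) (by linarith)
      have h2 : √(c ^ 2 - y) ^ k = c ^ k * (1 + -u) ^ (k / 2 : ℝ) := by
        have : c ^ 2 - y = c ^ 2 * (1 + -u) := by rw [hyu]; ring
        rw [this, Real.sqrt_mul (by positivity), Real.sqrt_sq hc.le, mul_pow,
          Real.sqrt_eq_rpow, ← Real.rpow_natCast, ← Real.rpow_natCast,
          ← Real.rpow_mul (by linarith)]
        congr 2; ring
      rw [h2]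
      calc c ^ k - k / 2 * y * c ^ (k - 2) = c ^ k * (1 + (k / 2 : ℝ) * (-u)) := by
            rw [hck, hyu]; ring
        _ ≤ _ := by gcongr

/-- The second order upper bound. The remainder involves `c ^ (k - 3)`, without negative powers of
`c`, which is why `k = 2` needs a separate treatment. -/
lemma sqrt_sub_pow_le {k : ℕ} (hk : 3 ≤ k) {c z : ℝ} (hc : 0 ≤ c) (hz : 0 ≤ z) :
    √(c ^ 2 - z ^ 2) ^ k ≤
      c ^ k - k / 2 * z ^ 2 * c ^ (k - 2) + √(k / 2) ^ 3 * z ^ 3 * c ^ (k - 3) := by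
  rcases hc.eq_or_lt with rfl | hc
  · rw [Real.sqrt_eq_zero_of_nonpos (by nlinarith [sq_nonneg z]), zero_pow (by omega : k ≠ 0),
      zero_pow (by omega : k - 2 ≠ 0)]
    have : (0 : ℝ) ≤ √(k / 2) ^ 3 * z ^ 3 * 0 ^ (k - 3) := by positivity
    linarith
  · have hck : c ^ k = c ^ 3 * c ^ (k - 3) := by rw [← pow_add]; congr 1; omega
    have hck2 : c ^ (k - 2) = c * c ^ (k - 3) := by rw [← pow_succ']; congr 1; omega
    set u := z / c with hu
    have hzu : z = c * u := by rw [hu]; field_simp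
    have hu0 : 0 ≤ u := by positivity
    set w := √(k / 2) * u with hw
    have hw2 : w ^ 2 = k / 2 * u ^ 2 := by rw [hw, mul_pow, Real.sq_sqrt (by positivity)]
    have h1 : √(1 - u ^ 2) ^ k ≤ Real.exp (-w ^ 2) := by
      calc √(1 - u ^ 2) ^ k ≤ √(Real.exp (-u ^ 2)) ^ k := by
            gcongr
            have := Real.add_one_le_exp (-u ^ 2)
            linarith
        _ = Real.exp (-w ^ 2) := by
            rw [← Real.exp_half, ← Real.exp_nat_mul, hw2]
            congr 1; ring
    have h2 : √(c ^ 2 - z ^ 2) = c * √(1 - u ^ 2) := by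
      rw [hzu, ← Real.sqrt_sq hc.le, Real.sqrt_sq hc.le, ← Real.sqrt_sq hc.le,
        ← Real.sqrt_mul (by positivity), Real.sqrt_sq hc.le]
      congr 1; ring
    rw [h2, mul_pow]
    have h3 := h1.trans (exp_neg_sq_le (mul_nonneg (Real.sqrt_nonneg _) hu0))
    calc c ^ k * √(1 - u ^ 2) ^ k ≤ c ^ k * (1 - w ^ 2 + w ^ 3) := by gcongr
      _ = _ := by rw [hw2, hck2, hw, hzu, hck]; ring

/-- The integral of a Cauchy density. -/
lemma integral_div_sq_add_sq_le {B c a : ℝ} (hB : 0 < B) (hc : 0 ≤ c) :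
    ∫ t in (0 : ℝ)..a, c / (B ^ 2 + t ^ 2) ≤ 2 * c / B := by
  have h : ∀ t : ℝ, c / (B ^ 2 + t ^ 2) = c / B ^ 2 * (1 + (t / B) ^ 2)⁻¹ := by
    intro t; field_simp
  simp_rw [h]
  rw [intervalIntegral.integral_const_mul,
    intervalIntegral.integral_comp_div (fun t => (1 + t ^ 2)⁻¹) hB.ne', integral_inv_one_add_sq,
    zero_div, Real.arctan_zero, sub_zero, smul_eq_mul]
  have h1 : Real.arctan (a / B) ≤ 2 :=
    (Real.arctan_lt_pi_div_two _).le.trans (by linarith [Real.pi_le_four])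
  calc c / B ^ 2 * (B * Real.arctan (a / B)) ≤ c / B ^ 2 * (B * 2) := by gcongr
    _ = 2 * c / B := by field_simp

namespace IsProfile

variable {a : ℝ} {g : ℝ → ℝ} {k : ℕ} (hg : IsProfile a g)

include hg

lemma profileIntegral_zero : profileIntegral a g k 0 = ∫ t in (0 : ℝ)..a, g t ^ k := by
  rw [profileIntegral]
  refine intervalIntegral.integral_congr fun t ht => ?_
  rw [uIcc_of_le hg.pos.le] at ht
  simp [Real.sqrt_sq (hg.nonneg t ht)]

lemma profileIntegral_le_zero (x : ℝ) : profileIntegral a g k x ≤ profileIntegral a g k 0 := by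
  refine intervalIntegral.integral_mono_on hg.pos.le (hg.intervalIntegrable x)
    (hg.intervalIntegrable 0) fun t _ => ?_
  rw [zero_pow two_ne_zero, zero_mul, sub_zero]
  gcongr
  have : 0 ≤ x ^ 2 * t ^ 2 := by positivity
  linarith

lemma intervalIntegrable_pow (i : ℕ) : IntervalIntegrable (fun t => g t ^ i) volume 0 a := by
  refine AntitoneOn.intervalIntegrable ?_
  rw [uIcc_of_le hg.pos.le]
  intro s hs t ht hst
  exact pow_le_pow_left₀ (hg.nonneg t ht) (hg.antitoneOn hs ht hst) i

lemma intervalIntegrable_mul_pow (j i : ℕ) :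
    IntervalIntegrable (fun t => t ^ j * g t ^ i) volume 0 a :=
  (hg.intervalIntegrable_pow i).continuousOn_mul (by fun_prop)

lemma profileIntegral_zero_le : profileIntegral a g k 0 ≤ a := by
  rw [hg.profileIntegral_zero]
  calc ∫ t in (0 : ℝ)..a, g t ^ k ≤ ∫ _ in (0 : ℝ)..a, (1 : ℝ) :=
        intervalIntegral.integral_mono_on hg.pos.le (hg.intervalIntegrable_pow k) (by simp)
          fun t ht => pow_le_one₀ (hg.nonneg t ht) (hg.le_one ht)
    _ = a := by simp

lemma mul_pow_le_profileIntegral {t : ℝ} (ht : t ∈ Icc 0 a) :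
    t * g t ^ k ≤ profileIntegral a g k 0 := by
  have hi := hg.intervalIntegrable_pow k
  rw [hg.profileIntegral_zero]
  have hint1 : IntervalIntegrable (fun t => g t ^ k) volume 0 t :=
    hi.mono_set (by
      rw [uIcc_of_le ht.1, uIcc_of_le hg.pos.le]; exact Icc_subset_Icc_right ht.2)
  calc t * g t ^ k = ∫ _ in (0 : ℝ)..t, g t ^ k := by simp
    _ ≤ ∫ u in (0 : ℝ)..t, g u ^ k := by
        refine intervalIntegral.integral_mono_on ht.1 (by simp) hint1 fun u hu => ?_
        exact pow_le_pow_left₀ (hg.nonneg t ht)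
          (hg.antitoneOn ⟨hu.1, hu.2.trans ht.2⟩ ht hu.2) k
    _ ≤ ∫ u in (0 : ℝ)..a, g u ^ k := by
        refine intervalIntegral.integral_mono_interval le_rfl ht.1 ht.2 ?_ hi
        refine (ae_restrict_iff' measurableSet_Ioc).2 (ae_of_all _ fun u hu => ?_)
        exact pow_nonneg (hg.nonneg u (Ioc_subset_Icc_self hu)) k

/-- Concavity forces the powers of a profile to decay at a rate governed by the volume alone: the
value at `t / 6` exceeds the sixth root of the value at `t`, and is itself controlled by
monotonicity. -/
lemma pow_mul_pow_le {t : ℝ} (ht : t ∈ Icc 0 a) {j : ℕ} (hj : j ≤ 3) (hjk : j ≤ k) :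
    t ^ j * g t ^ (k - j) ≤ 2 * (11 * profileIntegral a g k 0) ^ (j + 2) /
      ((11 * profileIntegral a g k 0) ^ 2 + t ^ 2) := by
  have ha := hg.pos
  rcases ht.1.eq_or_lt with rfl | ht0
  · have hV0 : 0 ≤ profileIntegral a g k 0 := by
      simpa using hg.mul_pow_le_profileIntegral (k := k) (left_mem_Icc.2 ha.le)
    rcases hV0.eq_or_lt with h0 | h0
    · rw [← h0]
      rcases Nat.eq_zero_or_pos k with rfl | hk
      · rw [hg.profileIntegral_zero] at h0
        simp at h0
        exact absurd h0 ha.ne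
      · exact absurd h0.symm (hg.profileIntegral_pos hk.ne' 0).ne'
    · set B := 11 * profileIntegral a g k 0 with hB
      have hB0 : 0 < B := by positivity
      rw [hg.map_zero, one_pow, mul_one, zero_pow two_ne_zero, add_zero, pow_add,
        ← mul_assoc, mul_div_assoc, div_self (by positivity), mul_one]
      have : (0 : ℝ) ^ j ≤ B ^ j := pow_le_pow_left₀ le_rfl hB0.le j
      nlinarith [pow_pos hB0 j]
  set V := profileIntegral a g k 0 with hV
  have ht6 : t / 6 ∈ Icc 0 a := ⟨by positivity, by linarith [ht.2]⟩
  have hgt0 := hg.nonneg t ht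
  have hgt1 := hg.le_one ht
  -- Monotonicity gives `g (t / 6) ^ k ≤ 6 V / t`, and the sixth power of this bound decays like
  -- `t⁻⁶`, fast enough to be integrable against `t³`.
  have h1 : (5 + g t) / 6 ≤ g (t / 6) := by
    have h := hg.concaveOn.2 (left_mem_Icc.2 ha.le) ht
      (show (0 : ℝ) ≤ 5 / 6 by norm_num) (show (0 : ℝ) ≤ 1 / 6 by norm_num) (by norm_num)
    simp only [smul_eq_mul, mul_zero, zero_add, hg.map_zero, mul_one] at h
    rw [show t / 6 = 1 / 6 * t by ring]
    linarith
  set G := (5 + g t) / 6 with hG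
  have hG0 : 5 / 6 ≤ G := by rw [hG]; linarith
  have hG0' : 0 < G := by linarith
  have h2 : t * G ^ k ≤ 6 * V := by
    have h3 := hg.mul_pow_le_profileIntegral (k := k) ht6
    have h4 : G ^ k ≤ g (t / 6) ^ k := pow_le_pow_left₀ hG0'.le h1 k
    have h5 := mul_le_mul_of_nonneg_left h4 ht6.1
    linarith
  have hV0 : 0 < V := by
    have : 0 < t * G ^ k := by positivity
    linarith
  have h3 : g t ≤ G ^ 6 := by
    have := one_add_mul_le_pow (show (-2 : ℝ) ≤ G - 1 by linarith) 6
    rw [add_sub_cancel] at this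
    refine le_trans (le_of_eq ?_) this
    rw [hG]; push_cast; ring
  set B := 11 * V with hB
  have hB0 : 0 < B := by positivity
  -- The constant `11` bounds `6 * (6 / 5) ^ 3`.
  have h4 : t * G ^ (k - j) ≤ B := by
    have h5 : G ^ k = G ^ j * G ^ (k - j) := by rw [← pow_add]; congr 1; omega
    have h6 : (5 / 6 : ℝ) ^ 3 ≤ G ^ j :=
      (pow_le_pow_of_le_one (by norm_num) (by norm_num) hj).trans
        (pow_le_pow_left₀ (by norm_num) hG0 j)
    have h7 : (5 / 6 : ℝ) ^ 3 * (t * G ^ (k - j)) ≤ G ^ j * (t * G ^ (k - j)) := by gcongr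
    have h8 : G ^ j * (t * G ^ (k - j)) = t * G ^ k := by rw [h5]; ring
    norm_num at h7
    linarith
  have h5 : t ^ 6 * g t ^ (k - j) ≤ B ^ 6 := by
    calc t ^ 6 * g t ^ (k - j) ≤ t ^ 6 * (G ^ 6) ^ (k - j) := by gcongr
      _ = (t * G ^ (k - j)) ^ 6 := by rw [mul_pow, pow_right_comm]
      _ ≤ B ^ 6 := by gcongr
  have h6 : g t ^ (k - j) ≤ 1 := pow_le_one₀ hgt0 hgt1
  have h7 : 0 ≤ g t ^ (k - j) := by positivity
  rw [le_div_iff₀ (by positivity)]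
  rcases le_total t B with htB | htB
  · calc t ^ j * g t ^ (k - j) * (B ^ 2 + t ^ 2) ≤ B ^ j * 1 * (B ^ 2 + B ^ 2) := by gcongr
      _ = 2 * B ^ (j + 2) := by ring
  · have h8 : B ^ (4 - j) * (t ^ (j + 2) * g t ^ (k - j)) ≤ B ^ (4 - j) * B ^ (j + 2) := by
      calc B ^ (4 - j) * (t ^ (j + 2) * g t ^ (k - j))
          ≤ t ^ (4 - j) * (t ^ (j + 2) * g t ^ (k - j)) := by gcongr
        _ = t ^ 6 * g t ^ (k - j) := by
            rw [← mul_assoc, ← pow_add]; congr 2; omega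
        _ ≤ B ^ 6 := h5
        _ = B ^ (4 - j) * B ^ (j + 2) := by rw [← pow_add]; congr 1; omega
    have h9 := le_of_mul_le_mul_left h8 (by positivity)
    calc t ^ j * g t ^ (k - j) * (B ^ 2 + t ^ 2)
        ≤ t ^ j * g t ^ (k - j) * (t ^ 2 + t ^ 2) := by gcongr
      _ = 2 * (t ^ (j + 2) * g t ^ (k - j)) := by ring
      _ ≤ 2 * B ^ (j + 2) := by gcongr

lemma integral_pow_mul_pow_le {j : ℕ} (hj : j ≤ 3) (hjk : j ≤ k) (hk : k ≠ 0) :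
    ∫ t in (0 : ℝ)..a, t ^ j * g t ^ (k - j) ≤ 4 * (11 * profileIntegral a g k 0) ^ (j + 1) := by
  have hV := hg.profileIntegral_pos hk 0
  set B := 11 * profileIntegral a g k 0 with hB
  have hB0 : 0 < B := by positivity
  calc ∫ t in (0 : ℝ)..a, t ^ j * g t ^ (k - j)
      ≤ ∫ t in (0 : ℝ)..a, 2 * B ^ (j + 2) / (B ^ 2 + t ^ 2) := by
        refine intervalIntegral.integral_mono_on hg.pos.le (hg.intervalIntegrable_mul_pow _ _)
          (ContinuousOn.intervalIntegrable ?_) fun t ht => hg.pow_mul_pow_le ht hj hjk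
        exact ContinuousOn.div (by fun_prop) (by fun_prop) fun t _ => by positivity
    _ ≤ 2 * (2 * B ^ (j + 2)) / B := integral_div_sq_add_sq_le hB0 (by positivity)
    _ = 4 * B ^ (j + 1) := by field_simp; ring

/-- The second moment is minimal, for a given volume, for the indicator of an interval. -/
lemma le_integral_sq_mul_pow (hk : 2 ≤ k) :
    profileIntegral a g k 0 ^ 3 / 3 ≤ ∫ t in (0 : ℝ)..a, t ^ 2 * g t ^ (k - 2) := by
  have ha := hg.pos
  have hV := hg.profileIntegral_pos (k := k) (by omega) 0
  have hVa := hg.profileIntegral_zero_le (k := k)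
  have hVi := hg.profileIntegral_zero (k := k)
  set V := profileIntegral a g k 0
  have hi := hg.intervalIntegrable_mul_pow 2 k
  have hi0 := hg.intervalIntegrable_pow k
  have h1 : ∫ t in (0 : ℝ)..a, t ^ 2 * g t ^ k ≤ ∫ t in (0 : ℝ)..a, t ^ 2 * g t ^ (k - 2) := by
    refine intervalIntegral.integral_mono_on ha.le hi (hg.intervalIntegrable_mul_pow _ _)
      fun t ht => ?_
    have h1 := hg.nonneg t ht
    have h2 := hg.le_one ht
    gcongr ?_ * ?_
    exact pow_le_pow_of_le_one h1 h2 (by omega)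
  have hi' : IntervalIntegrable (fun t => (t ^ 2 - V ^ 2) * g t ^ k) volume 0 a :=
    hi0.continuousOn_mul (by fun_prop)
  have hi1 : IntervalIntegrable (fun t => (t ^ 2 - V ^ 2) * g t ^ k) volume 0 V :=
    hi'.mono_set (by
      rw [uIcc_of_le hV.le, uIcc_of_le ha.le]; exact Icc_subset_Icc_right hVa)
  have hi2 : IntervalIntegrable (fun t => (t ^ 2 - V ^ 2) * g t ^ k) volume V a :=
    hi'.mono_set (by
      rw [uIcc_of_le hVa, uIcc_of_le ha.le]; exact Icc_subset_Icc_left hV.le)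
  have h2 : ∫ t in (0 : ℝ)..a, (t ^ 2 - V ^ 2) * g t ^ k =
      (∫ t in (0 : ℝ)..a, t ^ 2 * g t ^ k) - V ^ 3 := by
    simp_rw [sub_mul]
    rw [intervalIntegral.integral_sub hi (hi0.const_mul _), intervalIntegral.integral_const_mul,
      ← hVi]
    ring
  have h3 : 0 ≤ ∫ t in V..a, (t ^ 2 - V ^ 2) * g t ^ k := by
    refine intervalIntegral.integral_nonneg hVa fun t ht => ?_
    have := hg.nonneg t ⟨hV.le.trans ht.1, ht.2⟩
    have : V ^ 2 ≤ t ^ 2 := pow_le_pow_left₀ hV.le ht.1 2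
    exact mul_nonneg (by linarith) (by positivity)
  have h4 : ∫ t in (0 : ℝ)..V, (t ^ 2 - V ^ 2) ≤ ∫ t in (0 : ℝ)..V, (t ^ 2 - V ^ 2) * g t ^ k := by
    refine intervalIntegral.integral_mono_on hV.le (Continuous.intervalIntegrable (by fun_prop) _ _)
      hi1 fun t ht => ?_
    have h5 : t ∈ Icc 0 a := ⟨ht.1, ht.2.trans hVa⟩
    have h6 : t ^ 2 ≤ V ^ 2 := pow_le_pow_left₀ ht.1 ht.2 2
    have h7 : g t ^ k ≤ 1 := pow_le_one₀ (hg.nonneg t h5) (hg.le_one h5)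
    nlinarith
  have h5 : ∫ t in (0 : ℝ)..V, (t ^ 2 - V ^ 2) = V ^ 3 / 3 - V ^ 3 := by
    rw [intervalIntegral.integral_sub (by simp) (by simp)]
    simp
    ring
  have h6 := intervalIntegral.integral_add_adjacent_intervals hi1 hi2
  linarith

/-- For the exponent `2` the profile meets the slope only close to the end of the interval, where
the correction to the second order expansion is of third order. -/
lemma profileIntegral_two_le {x : ℝ} (hx : 0 ≤ x) :
    profileIntegral a g 2 x ≤ profileIntegral a g 2 0 - x ^ 2 * (∫ t in (0 : ℝ)..a, t ^ 2) +
      81 * x ^ 3 * profileIntegral a g 2 0 ^ 4 := by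
  have ha := hg.pos
  -- The cone `1 - t / a` lies below `g`, so that `a` is controlled by the volume.
  have haV : a ≤ 3 * profileIntegral a g 2 0 := by
    rw [hg.profileIntegral_zero]
    have : ∫ t in (0 : ℝ)..a, (1 - t / a) ^ 2 ≤ ∫ t in (0 : ℝ)..a, g t ^ 2 := by
      refine intervalIntegral.integral_mono_on ha.le
        (Continuous.intervalIntegrable (by fun_prop) _ _) (hg.intervalIntegrable_pow 2)
        fun t ht => ?_
      have h0 : 0 ≤ 1 - t / a := by rw [sub_nonneg, div_le_one ha]; exact ht.2
      exact pow_le_pow_left₀ h0 (hg.one_sub_div_le ht) 2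
    have h2 : ∫ t in (0 : ℝ)..a, (1 - t / a) ^ 2 = a / 3 := by
      have h3 : ∀ t : ℝ, (1 - t / a) ^ 2 = 1 - 2 / a * t + 1 / a ^ 2 * t ^ 2 := by
        intro t; field_simp; ring
      simp_rw [h3]
      rw [intervalIntegral.integral_add (Continuous.intervalIntegrable (by fun_prop) _ _)
        (Continuous.intervalIntegrable (by fun_prop) _ _), intervalIntegral.integral_sub (by simp)
        (Continuous.intervalIntegrable (by fun_prop) _ _), intervalIntegral.integral_const_mul,
        intervalIntegral.integral_const_mul]
      simp
      field_simp
      ring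
    linarith
  -- The radicand can be negative only where `1 - t / a < x * t`, in particular only for `t > c`.
  set c := max 0 (a - x * a ^ 2) with hc
  have hc0 : 0 ≤ c := le_max_left _ _
  have hca : c ≤ a := max_le ha.le (by nlinarith [mul_nonneg hx (sq_nonneg a)])
  have hint : ∫ t in (0 : ℝ)..a, (Ioi c).indicator (fun _ => x ^ 2 * a ^ 2) t =
      (a - c) * (x ^ 2 * a ^ 2) := by
    rw [intervalIntegral.integral_of_le ha.le, setIntegral_indicator measurableSet_Ioi]
    rw [show Ioc 0 a ∩ Ioi c = Ioc c a by
      ext t; simp only [mem_inter_iff, mem_Ioc, mem_Ioi]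
      constructor
      · rintro ⟨h1, h2⟩; exact ⟨h2, h1.2⟩
      · rintro ⟨h1, h2⟩; exact ⟨⟨hc0.trans_lt h1, h2⟩, h1⟩]
    simp [hca]
  have hii : IntervalIntegrable ((Ioi c).indicator (fun _ => x ^ 2 * a ^ 2)) volume 0 a := by
    rw [intervalIntegrable_iff_integrableOn_Ioc_of_le ha.le]
    exact (integrableOn_const (by simp)).indicator measurableSet_Ioi
  have hi2 : IntervalIntegrable (fun t : ℝ => x ^ 2 * t ^ 2) volume 0 a :=
    Continuous.intervalIntegrable (by fun_prop) _ _
  have h1 : profileIntegral a g 2 x ≤ ∫ t in (0 : ℝ)..a,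
      (g t ^ 2 - x ^ 2 * t ^ 2 + (Ioi c).indicator (fun _ => x ^ 2 * a ^ 2) t) := by
    refine intervalIntegral.integral_mono_on ha.le (hg.intervalIntegrable x)
      (((hg.intervalIntegrable_pow 2).sub hi2).add hii) fun t ht => ?_
    have hind : 0 ≤ (Ioi c).indicator (fun _ => x ^ 2 * a ^ 2) t :=
      indicator_nonneg (fun _ _ => by positivity) t
    rcases le_total (x ^ 2 * t ^ 2) (g t ^ 2) with h | h
    · rw [Real.sq_sqrt (by linarith)]
      linarith
    · rw [Real.sqrt_eq_zero_of_nonpos (by linarith), zero_pow two_ne_zero]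
      by_cases htc : t ∈ Ioi c
      · rw [indicator_of_mem htc]
        have : x ^ 2 * t ^ 2 ≤ x ^ 2 * a ^ 2 := by
          have := ht.1
          have := ht.2
          gcongr
        nlinarith [sq_nonneg (g t)]
      · have htc' : t ≤ c := not_lt.1 htc
        have ht1 : t ≤ a - x * a ^ 2 ∨ t = 0 := by
          rcases le_max_iff.1 (htc'.trans_eq hc) with h | h
          · exact Or.inr (le_antisymm h ht.1)
          · exact Or.inl h
        rcases ht1 with h1 | h1
        · have h2 := hg.one_sub_div_le ht
          have h3 : x * a ≤ 1 - t / a := by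
            rw [le_sub_iff_add_le', ← le_sub_iff_add_le, div_le_iff₀ ha]
            linarith
          have h4 : x * t ≤ g t := by
            have := mul_le_mul_of_nonneg_left ht.2 hx
            linarith
          have h5 : (x * t) ^ 2 ≤ g t ^ 2 := pow_le_pow_left₀ (mul_nonneg hx ht.1) h4 2
          nlinarith
        · subst h1
          rw [hg.map_zero] at h
          norm_num at h
  rw [intervalIntegral.integral_add ((hg.intervalIntegrable_pow 2).sub hi2) hii,
    intervalIntegral.integral_sub (hg.intervalIntegrable_pow 2) hi2,
    intervalIntegral.integral_const_mul, hint, ← hg.profileIntegral_zero] at h1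
  have h2 : (a - c) * (x ^ 2 * a ^ 2) ≤ 81 * x ^ 3 * profileIntegral a g 2 0 ^ 4 := by
    have h3 : a - c ≤ x * a ^ 2 := by linarith [le_max_right 0 (a - x * a ^ 2)]
    calc (a - c) * (x ^ 2 * a ^ 2) ≤ x * a ^ 2 * (x ^ 2 * a ^ 2) := by gcongr
      _ = x ^ 3 * a ^ 4 := by ring
      _ ≤ x ^ 3 * (3 * profileIntegral a g 2 0) ^ 4 := by gcongr
      _ = _ := by ring
  linarith

lemma profileIntegral_ge (hk : 2 ≤ k) (x : ℝ) :
    profileIntegral a g k 0 - k / 2 * x ^ 2 * (∫ t in (0 : ℝ)..a, t ^ 2 * g t ^ (k - 2)) ≤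
      profileIntegral a g k x := by
  have hi := hg.intervalIntegrable_pow k
  have hi2 := (hg.intervalIntegrable_mul_pow 2 (k - 2)).const_mul (k / 2 * x ^ 2)
  rw [hg.profileIntegral_zero, ← intervalIntegral.integral_const_mul,
    ← intervalIntegral.integral_sub hi hi2]
  refine intervalIntegral.integral_mono_on hg.pos.le (hi.sub hi2) (hg.intervalIntegrable x)
    fun t ht => ?_
  have := sqrt_sub_pow_ge hk (hg.nonneg t ht) (show 0 ≤ x ^ 2 * t ^ 2 by positivity)
  linarith

lemma profileIntegral_le (hk : 3 ≤ k) {x : ℝ} (hx : 0 ≤ x) :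
    profileIntegral a g k x ≤ profileIntegral a g k 0 -
      k / 2 * x ^ 2 * (∫ t in (0 : ℝ)..a, t ^ 2 * g t ^ (k - 2)) +
      √(k / 2) ^ 3 * x ^ 3 * (∫ t in (0 : ℝ)..a, t ^ 3 * g t ^ (k - 3)) := by
  have hi := hg.intervalIntegrable_pow k
  have hi2 := (hg.intervalIntegrable_mul_pow 2 (k - 2)).const_mul (k / 2 * x ^ 2)
  have hi3 := (hg.intervalIntegrable_mul_pow 3 (k - 3)).const_mul (√(k / 2) ^ 3 * x ^ 3)
  rw [hg.profileIntegral_zero, ← intervalIntegral.integral_const_mul,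
    ← intervalIntegral.integral_const_mul,
    ← intervalIntegral.integral_sub hi hi2, ← intervalIntegral.integral_add (hi.sub hi2) hi3]
  refine intervalIntegral.integral_mono_on hg.pos.le (hg.intervalIntegrable x)
    ((hi.sub hi2).add hi3) fun t ht => ?_
  have := sqrt_sub_pow_le hk (hg.nonneg t ht) (mul_nonneg hx ht.1)
  rw [mul_pow] at this
  linarith

/-- In the scale-invariant variable `X = √(k / 2) * x * V`, where `V` is the central value, the
section integral is `V (1 - q X² + O(X³))` with absolute bounds on `q` and on the remainder. -/
theorem exists_expansion (hk : 2 ≤ k) : ∃ q : ℝ, 1 / 3 ≤ q ∧ q ≤ 60000 ∧ ∀ x, 0 ≤ x →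
    1 - q * (√(k / 2) * x * profileIntegral a g k 0) ^ 2 ≤
      profileIntegral a g k x / profileIntegral a g k 0 ∧
    profileIntegral a g k x / profileIntegral a g k 0 ≤
      1 - q * (√(k / 2) * x * profileIntegral a g k 0) ^ 2 +
        60000 * (√(k / 2) * x * profileIntegral a g k 0) ^ 3 := by
  have hV := hg.profileIntegral_pos (k := k) (by omega) 0
  have h1 := hg.le_integral_sq_mul_pow hk
  have h2 := hg.integral_pow_mul_pow_le (j := 2) (by norm_num) hk (by omega)
  have h3 := hg.profileIntegral_ge hk
  have h4 : ∀ x, 0 ≤ x → profileIntegral a g k x ≤ profileIntegral a g k 0 -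
      k / 2 * x ^ 2 * (∫ t in (0 : ℝ)..a, t ^ 2 * g t ^ (k - 2)) +
      60000 * (√(k / 2) ^ 3 * x ^ 3 * profileIntegral a g k 0 ^ 4) := by
    intro x hx
    have hpos : 0 ≤ x ^ 3 * profileIntegral a g k 0 ^ 4 := by positivity
    rcases hk.eq_or_lt with rfl | hk3
    · have := hg.profileIntegral_two_le hx
      norm_num at this ⊢
      linarith
    · have h5 := hg.profileIntegral_le hk3 hx
      have h6 := hg.integral_pow_mul_pow_le (j := 3) (by norm_num) hk3 (by omega)
      have h7 := mul_le_mul_of_nonneg_left h6 (show 0 ≤ √(k / 2 : ℝ) ^ 3 * x ^ 3 by positivity)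
      have h8 : 0 ≤ √(k / 2 : ℝ) ^ 3 * x ^ 3 * profileIntegral a g k 0 ^ 4 := by positivity
      nlinarith
  set V := profileIntegral a g k 0
  set Q := ∫ t in (0 : ℝ)..a, t ^ 2 * g t ^ (k - 2)
  have hsq : ∀ x : ℝ, Q / V ^ 3 * (√(k / 2) * x * V) ^ 2 = k / 2 * x ^ 2 * Q / V := by
    intro x
    rw [mul_pow, mul_pow, Real.sq_sqrt (by positivity)]
    field_simp
  refine ⟨Q / V ^ 3, ?_, ?_, fun x hx => ⟨?_, ?_⟩⟩
  · rw [le_div_iff₀ (by positivity)]; linarith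
  · rw [div_le_iff₀ (by positivity)]
    have : 0 < V ^ 3 := by positivity
    norm_num at h2
    nlinarith
  · rw [hsq, le_div_iff₀ hV, sub_mul, div_mul_cancel₀ _ hV.ne', one_mul]
    exact h3 x
  · rw [hsq, div_le_iff₀ hV, add_mul, sub_mul, div_mul_cancel₀ _ hV.ne', one_mul]
    refine (h4 x hx).trans (le_of_eq ?_)
    ring

end IsProfile

/-! ### Convex even functions -/

section ConvexEven

variable {P : ℝ → ℝ} (hP : ConvexOn ℝ univ P) (heven : ∀ x, P (-x) = P x)

include hP

lemma convexOn_sub_le_slope {x y : ℝ} (hx : 0 < x) (hxy : x ≤ y) :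
    (P x - P 0) / x ≤ (P y - P 0) / y := by
  have hy := hx.trans_le hxy
  have h := hP.2 (mem_univ 0) (mem_univ y) (show 0 ≤ 1 - x / y by
    rw [sub_nonneg, div_le_one hy]; exact hxy) (show 0 ≤ x / y by positivity) (by ring)
  simp only [smul_eq_mul, mul_zero, zero_add, div_mul_cancel₀ _ hy.ne'] at h
  rw [div_le_iff₀ hx]
  have : (P y - P 0) / y * x = x / y * (P y - P 0) := by ring
  rw [this]
  linarith

/-- Increments of a convex function over intervals of a given length increase. -/
lemma convexOn_sub_le_sub {s y : ℝ} (hs : 0 ≤ s) (hy : 0 ≤ y) : P y - P 0 ≤ P (s + y) - P s := by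
  rcases (add_nonneg hs hy).eq_or_lt with h0 | h0
  · have h1 : s = 0 := by linarith
    have h2 : y = 0 := by linarith
    simp [h1, h2]
  · have e : s / (s + y) + y / (s + y) = 1 := by rw [← add_div, div_self h0.ne']
    have h1 := hP.2 (mem_univ (s + y)) (mem_univ 0) (show 0 ≤ s / (s + y) by positivity)
      (show 0 ≤ y / (s + y) by positivity) e
    have h2 := hP.2 (mem_univ (s + y)) (mem_univ 0) (show 0 ≤ y / (s + y) by positivity)
      (show 0 ≤ s / (s + y) by positivity) (by rw [add_comm]; exact e)
    simp only [smul_eq_mul, mul_zero, add_zero, div_mul_cancel₀ _ h0.ne'] at h1 h2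
    have h3 : s / (s + y) * P (s + y) + y / (s + y) * P 0 +
        (y / (s + y) * P (s + y) + s / (s + y) * P 0) = P (s + y) + P 0 := by
      linear_combination (P (s + y) + P 0) * e
    linarith

include heven

lemma convexOn_even_mono {x y : ℝ} (hx : 0 ≤ x) (hxy : x ≤ y) : P x ≤ P y := by
  rcases (hx.trans hxy).eq_or_lt with h0 | h0
  · rw [show x = y by linarith]
  · have h := hP.2 (mem_univ (-y)) (mem_univ y) (show 0 ≤ (1 - x / y) / 2 by
      have : x / y ≤ 1 := by rw [div_le_one h0]; exact hxy
      linarith) (show 0 ≤ (1 + x / y) / 2 by positivity) (by ring)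
    rw [heven] at h
    simp only [smul_eq_mul] at h
    rw [show (1 - x / y) / 2 * -y + (1 + x / y) / 2 * y = x by field_simp; ring] at h
    linarith

end ConvexEven

/-! ### The modulus of convexity at the equator -/

/-- `L` is the unit ball of a gauge which is `|σ| / A` on the axis and which, off the axis, is the
perspective of an even convex function `P` of the cotangent of the angle to the axis. -/
structure IsAxialGauge {n : ℕ} (L : Set (Euc n)) (A : ℝ) (P : ℝ → ℝ) : Prop where
  two_le : 2 ≤ n
  axis_pos : 0 < A
  pos : ∀ x, 0 < P x
  even : ∀ x, P (-x) = P x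
  convexOn : ConvexOn ℝ univ P
  mem_iff : ∀ v, v ∈ L ↔ gauge L v ≤ 1
  gauge_axis : ∀ σ : ℝ, gauge L (σ • axisVec n) = |σ| / A
  gauge_off_axis : ∀ (σ : ℝ) (w : Euc n), w ≠ 0 → inner ℝ (axisVec n) w = 0 →
    gauge L (σ • axisVec n + w) = ‖w‖ * P (σ / ‖w‖)

lemma norm_coordVec {n k : ℕ} (hk : k < n) : ‖coordVec n k‖ = 1 := by
  have : coordVec n k = EuclideanSpace.single (⟨k, hk⟩ : Fin n) (1 : ℝ) := by
    ext i
    simp [coordVec, Fin.ext_iff]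
  rw [this]; simp

lemma inner_axisVec_coordVec_one {n : ℕ} : inner ℝ (axisVec n) (coordVec n 1) = 0 := by
  simp only [PiLp.inner_apply, coordVec]
  refine Finset.sum_eq_zero fun i _ => ?_
  by_cases h : (i : ℕ) = 0 <;> simp [h]

namespace IsAxialGauge

variable {n : ℕ} {L : Set (Euc n)} {A : ℝ} {P : ℝ → ℝ} (hL : IsAxialGauge L A P)

include hL

lemma even_abs (x : ℝ) : P |x| = P x := by
  rcases abs_choice x with h | h <;> rw [h]
  exact hL.even x

/-- The midpoint of a chord parallel to the axis either lies on the axis, or is described by its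
distance `N` from the axis and its cotangent `S`. -/
lemma midpoint_cases {ε : ℝ} (hε : 0 ≤ ε) {x y : Euc n} (hx : x ∈ L) (hy : y ∈ L)
    (hxy : 2 * ε ≤ gauge L (x - y)) (hs : x - y ∈ Submodule.span ℝ {axisVec n}) :
    gauge L ((1 / 2 : ℝ) • (x + y)) ≤ 1 - ε ∨
    ∃ N S : ℝ, 0 < N ∧ 0 ≤ S ∧ N * P (S + ε * A / N) ≤ 1 ∧
      gauge L ((1 / 2 : ℝ) • (x + y)) = N * P S := by
  have hA := hL.axis_pos
  obtain ⟨c, hc⟩ := Submodule.mem_span_singleton.1 hs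
  have he : ‖axisVec n‖ = 1 := norm_coordVec (by have := hL.two_le; omega)
  set m := (1 / 2 : ℝ) • (x + y) with hm
  set s : ℝ := inner ℝ (axisVec n) m with hsdef
  set w := m - s • axisVec n with hw
  have hwe : inner ℝ (axisVec n) w = 0 := by
    rw [hw, inner_sub_right, inner_smul_right _ (axisVec n) s, real_inner_self_eq_norm_sq, he,
      ← hsdef]
    ring
  have hmw : m = s • axisVec n + w := by rw [hw]; abel
  have hxm : x = (s + c / 2) • axisVec n + w := by
    have : x = m + (1 / 2 : ℝ) • (x - y) := by rw [hm]; module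
    rw [this, ← hc, hmw]; module
  have hym : y = (s - c / 2) • axisVec n + w := by
    have : y = m - (1 / 2 : ℝ) • (x - y) := by rw [hm]; module
    rw [this, ← hc, hmw]; module
  rw [← hc, hL.gauge_axis, le_div_iff₀ hA] at hxy
  have hx1 := (hL.mem_iff x).1 hx
  have hy1 := (hL.mem_iff y).1 hy
  -- One of the two ends of the chord is at distance `|s| + |c / 2|` along the axis.
  have hends : |s| + |c / 2| = |s + c / 2| ∨ |s| + |c / 2| = |s - c / 2| := by
    rcases abs_cases s with h1 | h1 <;> rcases abs_cases (c / 2) with h2 | h2 <;>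
      rcases abs_cases (s + c / 2) with h3 | h3 <;> rcases abs_cases (s - c / 2) with h4 | h4 <;>
      first
        | (left; linarith)
        | (right; linarith)
  have hc2 : ε * A ≤ |c / 2| := by
    rw [abs_div, abs_of_pos (show (0 : ℝ) < 2 by norm_num)]; linarith
  by_cases hw0 : w = 0
  · left
    rw [hxm, hw0, add_zero, hL.gauge_axis, div_le_one hA] at hx1
    rw [hym, hw0, add_zero, hL.gauge_axis, div_le_one hA] at hy1
    rw [hmw, hw0, add_zero, hL.gauge_axis, div_le_iff₀ hA]
    rcases hends with h | h <;> linarith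
  · right
    have hN : 0 < ‖w‖ := norm_pos_iff.2 hw0
    refine ⟨‖w‖, |s| / ‖w‖, hN, by positivity, ?_, ?_⟩
    · have h1 : ‖w‖ * P ((|s| + |c / 2|) / ‖w‖) ≤ 1 := by
        rw [hxm, hL.gauge_off_axis _ _ hw0 hwe] at hx1
        rw [hym, hL.gauge_off_axis _ _ hw0 hwe] at hy1
        rcases hends with h | h <;> rw [h, ← abs_of_pos hN, ← abs_div, hL.even_abs, abs_of_pos hN]
        · exact hx1
        · exact hy1
      refine le_trans (mul_le_mul_of_nonneg_left ?_ hN.le) h1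
      rw [← add_div]
      exact convexOn_even_mono hL.convexOn hL.even (by positivity) (by gcongr)
    · rw [hmw, hL.gauge_off_axis _ _ hw0 hwe, ← hL.even_abs, abs_div, abs_of_pos hN]

lemma gauge_midpoint_le_one {ε : ℝ} (hε : 0 ≤ ε) {x y : Euc n} (hx : x ∈ L) (hy : y ∈ L)
    (hxy : 2 * ε ≤ gauge L (x - y)) (hs : x - y ∈ Submodule.span ℝ {axisVec n}) :
    gauge L ((1 / 2 : ℝ) • (x + y)) ≤ 1 := by
  have hA := hL.axis_pos
  rcases hL.midpoint_cases hε hx hy hxy hs with h | ⟨N, S, hN, hS, h1, h2⟩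
  · linarith
  · rw [h2]
    refine le_trans (mul_le_mul_of_nonneg_left ?_ hN.le) h1
    exact convexOn_even_mono hL.convexOn hL.even hS (le_add_of_nonneg_right (by positivity))

lemma bddBelow_modulus {ε : ℝ} (hε : 0 ≤ ε) :
    BddBelow {d : ℝ | ∃ x ∈ L, ∃ y ∈ L, 2 * ε ≤ gauge L (x - y) ∧
      x - y ∈ Submodule.span ℝ {axisVec n} ∧ d = 1 - gauge L ((1 / 2 : ℝ) • (x + y))} := by
  refine ⟨0, ?_⟩
  rintro d ⟨x, hx, y, hy, hxy, hs, rfl⟩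
  have := hL.gauge_midpoint_le_one hε hx hy hxy hs
  linarith

/-- The axis itself is an admissible chord. -/
lemma one_mem_modulus {ε : ℝ} (hε1 : ε ≤ 1) :
    (1 : ℝ) ∈ {d : ℝ | ∃ x ∈ L, ∃ y ∈ L, 2 * ε ≤ gauge L (x - y) ∧
      x - y ∈ Submodule.span ℝ {axisVec n} ∧ d = 1 - gauge L ((1 / 2 : ℝ) • (x + y))} := by
  have hA := hL.axis_pos
  refine ⟨A • axisVec n, ?_, (-A) • axisVec n, ?_, ?_, ?_, ?_⟩
  · rw [hL.mem_iff, hL.gauge_axis, abs_of_pos hA, div_self hA.ne']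
  · rw [hL.mem_iff, hL.gauge_axis, abs_neg, abs_of_pos hA, div_self hA.ne']
  · rw [← sub_smul, hL.gauge_axis, sub_neg_eq_add, abs_of_pos (by positivity), le_div_iff₀ hA]
    nlinarith
  · rw [← sub_smul]
    exact Submodule.smul_mem _ _ (Submodule.mem_span_singleton_self _)
  · rw [← add_smul, add_neg_cancel, zero_smul, smul_zero, gauge_zero, sub_zero]

lemma modulus_le_one {ε : ℝ} (hε : 0 ≤ ε) (hε1 : ε ≤ 1) : equatorialModulus L ε ≤ 1 :=
  csInf_le (hL.bddBelow_modulus hε) (hL.one_mem_modulus hε1)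

lemma modulus_nonneg {ε : ℝ} (hε : 0 ≤ ε) (hε1 : ε ≤ 1) : 0 ≤ equatorialModulus L ε := by
  refine le_csInf ⟨1, hL.one_mem_modulus hε1⟩ ?_
  rintro d ⟨x, hx, y, hy, hxy, hs, rfl⟩
  have := hL.gauge_midpoint_le_one hε hx hy hxy hs
  linarith

lemma modulus_mono {ε ε' : ℝ} (hε : 0 ≤ ε) (h : ε ≤ ε') (hε1 : ε' ≤ 1) :
    equatorialModulus L ε ≤ equatorialModulus L ε' := by
  refine csInf_le_csInf (hL.bddBelow_modulus hε) ⟨1, hL.one_mem_modulus hε1⟩ ?_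
  rintro d ⟨x, hx, y, hy, hxy, hs, rfl⟩
  exact ⟨x, hx, y, hy, by linarith, hs, rfl⟩

/-- The chord realizing the modulus is centred on the equatorial hyperplane: the ratio
`x = ε A P(x)` is the least cotangent at which the body has half-width at least `ε A`. -/
lemma modulus_eq {ε x : ℝ} (hε : 0 < ε) (hx : 0 < x) (hxP : x = ε * A * P x)
    (hmin : ∀ y, 0 ≤ y → ε * A * P y ≤ y → x ≤ y) (hsmall : 1 - P 0 / P x ≤ ε) :
    equatorialModulus L ε = 1 - P 0 / P x := by
  have hA := hL.axis_pos
  have hPx := hL.pos x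
  have hh : 0 < ε * A := by positivity
  have he2 : ‖coordVec n 1‖ = 1 := norm_coordVec (by have := hL.two_le; omega)
  have hmem : 1 - P 0 / P x ∈ {d : ℝ | ∃ x ∈ L, ∃ y ∈ L, 2 * ε ≤ gauge L (x - y) ∧
      x - y ∈ Submodule.span ℝ {axisVec n} ∧ d = 1 - gauge L ((1 / 2 : ℝ) • (x + y))} := by
    set w : Euc n := (P x)⁻¹ • coordVec n 1 with hw
    have hwn : ‖w‖ = (P x)⁻¹ := by
      rw [hw, norm_smul, he2, mul_one, Real.norm_of_nonneg (by positivity)]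
    have hw0 : w ≠ 0 := norm_pos_iff.1 (by rw [hwn]; positivity)
    have hwe : inner ℝ (axisVec n) w = 0 := by
      rw [hw, inner_smul_right, inner_axisVec_coordVec_one, mul_zero]
    refine ⟨(ε * A) • axisVec n + w, ?_, (-(ε * A)) • axisVec n + w, ?_, ?_, ?_, ?_⟩
    · rw [hL.mem_iff, hL.gauge_off_axis _ _ hw0 hwe, hwn, div_inv_eq_mul, ← hxP,
        inv_mul_cancel₀ hPx.ne']
    · rw [hL.mem_iff, hL.gauge_off_axis _ _ hw0 hwe, hwn, neg_div, hL.even, div_inv_eq_mul,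
        ← hxP, inv_mul_cancel₀ hPx.ne']
    · rw [add_sub_add_right_eq_sub, ← sub_smul, hL.gauge_axis, sub_neg_eq_add,
        abs_of_pos (by positivity), le_div_iff₀ hA]
      linarith
    · rw [add_sub_add_right_eq_sub, ← sub_smul]
      exact Submodule.smul_mem _ _ (Submodule.mem_span_singleton_self _)
    · have : (1 / 2 : ℝ) • ((ε * A) • axisVec n + w + ((-(ε * A)) • axisVec n + w)) =
        (0 : ℝ) • axisVec n + w := by module
      rw [this, hL.gauge_off_axis _ _ hw0 hwe, hwn, zero_div]
      ring
  refine le_antisymm (csInf_le (hL.bddBelow_modulus hε.le) hmem) (le_csInf ⟨_, hmem⟩ ?_)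
  rintro d ⟨u, hu, v, hv, huv, hs, rfl⟩
  rcases hL.midpoint_cases hε.le hu hv huv hs with h | ⟨N, S, hN, hS, h1, h2⟩
  · linarith
  · rw [h2]
    set y := ε * A / N with hy
    have hy0 : 0 < y := by positivity
    have h3 : N * P y ≤ 1 := by
      refine le_trans (mul_le_mul_of_nonneg_left ?_ hN.le) h1
      exact convexOn_even_mono hL.convexOn hL.even hy0.le (le_add_of_nonneg_left hS)
    have hxy : x ≤ y := by
      refine hmin y hy0.le ?_
      have := mul_le_mul_of_nonneg_left h3 hy0.le
      have e : y * (N * P y) = ε * A * P y := by rw [hy]; field_simp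
      linarith
    have h4 := convexOn_sub_le_sub hL.convexOn hS hy0.le
    have h5 := convexOn_sub_le_slope hL.convexOn hx hxy
    have h6 : N * (P y - P 0) = ε * A * ((P y - P 0) / y) := by rw [hy]; field_simp
    have h7 : 1 - P 0 / P x = ε * A * ((P x - P 0) / x) := by
      have : (P x - P 0) / x = (P x - P 0) / (ε * A * P x) := by rw [← hxP]
      rw [this]; field_simp
    calc 1 - P 0 / P x = ε * A * ((P x - P 0) / x) := h7
      _ ≤ ε * A * ((P y - P 0) / y) := by gcongr
      _ = N * (P y - P 0) := h6.symm
      _ ≤ N * (P (S + y) - P S) := by gcongr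
      _ ≤ 1 - N * P S := by rw [mul_sub]; linarith

end IsAxialGauge

/-! ### The chord of given length and the expansion of the modulus -/

lemma isProfile_one {a : ℝ} (ha : 0 < a) : IsProfile a fun _ => 1 where
  pos := ha
  concaveOn := concaveOn_const _ (convex_Icc _ _)
  map_zero := rfl
  nonneg := by simp
  antitoneOn := fun _ _ _ _ _ => le_rfl

/-- Half of the quotient of the volumes of the unit balls in dimensions `k + 1` and `k`. -/
noncomputable def ballRatio (k : ℕ) : ℝ := profileIntegral 1 (fun _ => 1) k 1

/-- The lower bound integrates Bernoulli's inequality up to `1 / √(k / 2)`. -/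
lemma ballRatio_ge {k : ℕ} (hk : 2 ≤ k) : 2 / 3 ≤ √(k / 2) * ballRatio k := by
  have hk' : (2 : ℝ) ≤ k := by exact_mod_cast hk
  set μ := √(k / 2 : ℝ) with hμ
  have hμ1 : 1 ≤ μ := by rw [hμ, Real.one_le_sqrt]; linarith
  have hμ2 : μ ^ 2 = k / 2 := Real.sq_sqrt (by positivity)
  have hμ0 : 0 < μ := by linarith
  have h1 := (isProfile_one (a := 1 / μ) (by positivity)).profileIntegral_ge hk 1
  have h2 : profileIntegral (1 / μ) (fun _ => 1) k 1 ≤ ballRatio k := by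
    refine intervalIntegral.integral_mono_interval le_rfl (by positivity)
      (by rw [div_le_one hμ0]; exact hμ1) (ae_of_all _ fun t => by positivity)
      ((isProfile_one one_pos).intervalIntegrable 1)
  rw [(isProfile_one (by positivity)).profileIntegral_zero] at h1
  simp only [one_pow, mul_one, integral_pow, intervalIntegral.integral_const, smul_eq_mul] at h1
  have h3 : 1 / μ - 0 - k / 2 * (((1 / μ) ^ (2 + 1) - 0 ^ (2 + 1)) / ((2 : ℕ) + 1)) =
      2 / (3 * μ) := by
    rw [← hμ2, div_pow, one_pow, pow_succ]; push_cast; field_simp; norm_num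
  rw [h3] at h1
  have h4 := mul_le_mul_of_nonneg_left (h1.trans h2) hμ0.le
  refine le_trans (le_of_eq ?_) h4
  field_simp

lemma ballRatio_le {k : ℕ} (hk : 2 ≤ k) : √(k / 2) * ballRatio k ≤ 2 := by
  have hk' : (2 : ℝ) ≤ k := by exact_mod_cast hk
  set μ := √(k / 2 : ℝ) with hμ
  have hμ0 : 0 < μ := by rw [hμ]; positivity
  have hμ2 : μ ^ 2 = k / 2 := Real.sq_sqrt (by positivity)
  have h1 : ballRatio k ≤ ∫ t in (0 : ℝ)..1, (μ⁻¹ ^ 2) / (μ⁻¹ ^ 2 + t ^ 2) := by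
    refine intervalIntegral.integral_mono_on zero_le_one
      ((isProfile_one one_pos).intervalIntegrable 1)
      (ContinuousOn.intervalIntegrable
        (ContinuousOn.div (by fun_prop) (by fun_prop) fun t _ => by positivity)) fun t _ => ?_
    calc √(1 ^ 2 - 1 ^ 2 * t ^ 2) ^ k ≤ √(Real.exp (-t ^ 2)) ^ k := by
          gcongr
          have := Real.add_one_le_exp (-t ^ 2)
          linarith
      _ = (Real.exp (μ ^ 2 * t ^ 2))⁻¹ := by
          rw [← Real.exp_half, ← Real.exp_nat_mul, ← Real.exp_neg, hμ2]
          congr 1; ring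
      _ ≤ (1 + μ ^ 2 * t ^ 2)⁻¹ := by
          gcongr
          have := Real.add_one_le_exp (μ ^ 2 * t ^ 2)
          linarith
      _ = _ := by field_simp
  have h2 := h1.trans (integral_div_sq_add_sq_le (B := μ⁻¹) (by positivity) (by positivity))
  have h3 := mul_le_mul_of_nonneg_left h2 hμ0.le
  refine h3.trans (le_of_eq ?_)
  field_simp

lemma ballRatio_pos {k : ℕ} (hk : 2 ≤ k) : 0 < ballRatio k :=
  (isProfile_one one_pos).profileIntegral_pos (by omega) 1

lemma IsProfile.continuous_profileIntegral {a : ℝ} {g : ℝ → ℝ} {k : ℕ} (hg : IsProfile a g)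
    (hk : k ≠ 0) : Continuous (profileIntegral a g k) := by
  have h := (hg.convexOn_inv_profileIntegral hk).continuousOn isOpen_univ
  rw [continuousOn_univ] at h
  have := h.inv₀ fun x => inv_ne_zero (hg.profileIntegral_pos hk x).ne'
  exact this.congr fun x => inv_inv _

/-- For short chords the least solution of `x Ψ(x) = ε J` lies in the range where the expansion of
`Ψ` is effective. -/
theorem IsProfile.exists_least_chord {a : ℝ} {g : ℝ → ℝ} {k : ℕ} (hg : IsProfile a g)
    (hk : 2 ≤ k) : ∃ c : ℝ, 4 / 27 ≤ c ∧ c ≤ 240000 ∧ ∀ ε, 0 < ε → ε ≤ 1 / 2000 →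
      ∃ x, 0 < x ∧ x * profileIntegral a g k x = ε * ballRatio k ∧
        (∀ y, 0 ≤ y → ε * ballRatio k ≤ y * profileIntegral a g k y → x ≤ y) ∧
        |1 - profileIntegral a g k x / profileIntegral a g k 0 - c * ε ^ 2| ≤ 10 ^ 12 * ε ^ 3 := by
  obtain ⟨q, hq1, hq2, hexp⟩ := hg.exists_expansion hk
  have hk0 : k ≠ 0 := by omega
  have hj1 := ballRatio_ge hk
  have hj2 := ballRatio_le hk
  have hJ := ballRatio_pos hk
  have hV := hg.profileIntegral_pos hk0 0
  have hΨ := hg.profileIntegral_pos hk0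
  have hle := fun x => hg.profileIntegral_le_zero (k := k) x
  have hcont := hg.continuous_profileIntegral hk0
  have hμ : 0 < √(k / 2 : ℝ) := by
    have : (0 : ℝ) < k := by exact_mod_cast Nat.pos_of_ne_zero hk0
    positivity
  set Ψ := profileIntegral a g k
  set V := Ψ 0
  set μ := √(k / 2 : ℝ)
  set J := ballRatio k
  refine ⟨q * (μ * J) ^ 2, by nlinarith, ?_, fun ε hε hε1 => ?_⟩
  · have : (μ * J) ^ 2 ≤ 2 ^ 2 := by gcongr
    nlinarith
  have hcont' : Continuous fun y => y * Ψ y := continuous_id.mul hcont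
  set A : Set ℝ := {y | 0 ≤ y ∧ ε * J ≤ y * Ψ y} with hA
  have hclosed : IsClosed A :=
    (isClosed_le continuous_const continuous_id).inter (isClosed_le continuous_const hcont')
  have hbdd : BddBelow A := ⟨0, fun y hy => hy.1⟩
  -- Here `X = 4 ε`, so that `Ψ` is still at least half of its central value.
  have hx0 : 4 * ε / (μ * V) ∈ A := by
    refine ⟨by positivity, ?_⟩
    have h1 := (hexp (4 * ε / (μ * V)) (by positivity)).1
    have e : μ * (4 * ε / (μ * V)) * V = 4 * ε := by field_simp
    rw [e] at h1
    have h2 : 1 / 2 ≤ Ψ (4 * ε / (μ * V)) / V := by nlinarith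
    rw [le_div_iff₀ hV] at h2
    have h3 : 4 * ε / (μ * V) * (1 / 2 * V) ≤ 4 * ε / (μ * V) * Ψ (4 * ε / (μ * V)) := by gcongr
    refine le_trans ?_ h3
    have e2 : 4 * ε / (μ * V) * (1 / 2 * V) = 2 * ε / μ := by field_simp; norm_num
    rw [e2, le_div_iff₀ hμ]
    nlinarith
  have hxA : sInf A ∈ A := hclosed.csInf_mem ⟨_, hx0⟩ hbdd
  set x := sInf A with hx
  have hxle : x ≤ 4 * ε / (μ * V) := csInf_le hbdd hx0
  have hεJ : 0 < ε * J := by positivity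
  have hxpos : 0 < x := by
    refine lt_of_le_of_ne hxA.1 fun h => ?_
    have := hxA.2
    rw [← h, zero_mul] at this
    linarith
  -- A strict inequality at `x` would produce a smaller element of `A`.
  have hxeq : x * Ψ x = ε * J := by
    obtain ⟨z, hz, hzeq⟩ := intermediate_value_Icc hxA.1 hcont'.continuousOn
      (show ε * J ∈ Icc (0 * Ψ 0) (x * Ψ x) from ⟨by rw [zero_mul]; exact hεJ.le, hxA.2⟩)
    have hzA : z ∈ A := ⟨hz.1, hzeq.ge⟩
    have : z = x := le_antisymm hz.2 (csInf_le hbdd hzA)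
    rw [← this]; exact hzeq
  refine ⟨x, hxpos, hxeq, fun y hy hy2 => csInf_le hbdd ⟨hy, hy2⟩, ?_⟩
  obtain ⟨h1, h2⟩ := hexp x hxpos.le
  have hX0 : 0 < μ * x * V := by positivity
  have hX4 : μ * x * V ≤ 4 * ε := by
    rw [le_div_iff₀ (by positivity)] at hxle
    linarith
  have hXr : μ * x * V * (Ψ x / V) = μ * J * ε := by
    have : μ * x * V * (Ψ x / V) = μ * (x * Ψ x) := by field_simp
    rw [this, hxeq]; ring
  have hr1 : Ψ x / V ≤ 1 := by rw [div_le_one hV]; exact hle x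
  have hr0 : 0 < Ψ x / V := div_pos (hΨ x) hV
  set r := Ψ x / V
  set X := μ * x * V
  have e : q * (μ * J) ^ 2 * ε ^ 2 = q * X ^ 2 * r ^ 2 := by
    rw [mul_assoc, ← mul_pow, ← hXr]; ring
  rw [e]
  have hX3 : X ^ 3 ≤ 64 * ε ^ 3 := by
    calc X ^ 3 ≤ (4 * ε) ^ 3 := by gcongr
      _ = _ := by ring
  have hε3 : 0 < ε ^ 3 := by positivity
  have hX2 : 0 < X ^ 2 := by positivity
  have hD : 1 - r ≤ q * X ^ 2 := by linarith
  have h5 : 0 ≤ q * X ^ 2 * (1 - r ^ 2) := by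
    have : 0 ≤ 1 - r ^ 2 := by nlinarith
    positivity
  have h6 : q * X ^ 2 * (1 - r ^ 2) ≤ 2 * q ^ 2 * X ^ 4 := by
    have : 1 - r ^ 2 ≤ 2 * (q * X ^ 2) := by nlinarith
    calc q * X ^ 2 * (1 - r ^ 2) ≤ q * X ^ 2 * (2 * (q * X ^ 2)) := by gcongr
      _ = _ := by ring
  have h7 : 2 * q ^ 2 * X ^ 4 ≤ 60000 ^ 2 * X ^ 3 := by
    have hX1 : X ≤ 1 / 2 := by linarith
    calc 2 * q ^ 2 * X ^ 4 = q ^ 2 * X ^ 3 * (2 * X) := by ring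
      _ ≤ 60000 ^ 2 * X ^ 3 * 1 := by gcongr; linarith
      _ = _ := by ring
  rw [abs_le]
  constructor <;> nlinarith

/-! ### The profile of a body of revolution -/

/-- The radius of the section of `K` by the hyperplane orthogonal to the axis at height `τ`. It is
`0` if that section is empty. -/
noncomputable def sectionRadius {n : ℕ} (K : Set (Euc n)) (τ : ℝ) : ℝ :=
  sSup {r : ℝ | 0 ≤ r ∧ τ • axisVec n + r • coordVec n 1 ∈ K}

/-- Half of the length of the intersection of `K` with its axis. -/
noncomputable def halfLength {n : ℕ} (K : Set (Euc n)) : ℝ :=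
  sSup {t : ℝ | t • axisVec n ∈ K}

lemma norm_axisVec {n : ℕ} (hn : 2 ≤ n) : ‖axisVec n‖ = 1 := norm_coordVec (by omega)

lemma norm_coordVec_one {n : ℕ} (hn : 2 ≤ n) : ‖coordVec n 1‖ = 1 := norm_coordVec (by omega)

lemma sectionRadius_nonneg {n : ℕ} (K : Set (Euc n)) (τ : ℝ) : 0 ≤ sectionRadius K τ :=
  Real.sSup_nonneg fun _ h => h.1

/-- In the direction of a vector a bounded set reaches only bounded multiples. -/
lemma bddAbove_smul_mem {n : ℕ} {K : Set (Euc n)} (hK : Bornology.IsBounded K) (p : Euc n)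
    {v : Euc n} (hv : ‖v‖ = 1) : BddAbove {r : ℝ | p + r • v ∈ K} := by
  obtain ⟨M, hM⟩ := hK.exists_norm_le
  refine ⟨M + ‖p‖, fun r hr => ?_⟩
  have h1 := hM _ hr
  have h2 : ‖r • v‖ ≤ ‖p + r • v‖ + ‖p‖ := by
    have := norm_sub_le (p + r • v) p
    rwa [add_sub_cancel_left] at this
  rw [norm_smul, hv, mul_one, Real.norm_eq_abs] at h2
  linarith [le_abs_self r]

namespace IsSymmConvexBodyOfRevolution

variable {n : ℕ} {K : Set (Euc n)} (hK : IsSymmConvexBodyOfRevolution K) (hn : 2 ≤ n)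

include hK

lemma neg_mem {x : Euc n} (hx : x ∈ K) : -x ∈ K := by
  rw [← hK.symm] at hx
  simpa using hx

lemma zero_mem_interior : (0 : Euc n) ∈ interior K := by
  obtain ⟨x, hx⟩ := hK.interior_nonempty
  have h2 : -x ∈ K := hK.neg_mem (interior_subset hx)
  have := hK.convex.combo_interior_self_mem_interior hx h2 (a := 1 / 2) (b := 1 / 2)
    (by norm_num) (by norm_num) (by norm_num)
  simpa using this

lemma zero_mem : (0 : Euc n) ∈ K := interior_subset hK.zero_mem_interior

/-- The reflection exchanging two vectors of equal length orthogonal to the axis fixes the axis. -/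
lemma mem_of_norm_eq {τ : ℝ} {w w' : Euc n} (hw : inner ℝ (axisVec n) w = 0)
    (hw' : inner ℝ (axisVec n) w' = 0) (h : ‖w‖ = ‖w'‖) (hmem : τ • axisVec n + w ∈ K) :
    τ • axisVec n + w' ∈ K := by
  set ρ := (ℝ ∙ (w - w'))ᗮ.reflection with hρ
  have h1 : ρ w = w' := Submodule.reflection_sub h
  have h2 : ρ (axisVec n) = axisVec n := by
    refine Submodule.reflection_mem_subspace_eq_self ?_
    rw [Submodule.mem_orthogonal_singleton_iff_inner_left, inner_sub_right, hw, hw', sub_zero]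
  have h3 := hK.revolution ρ h2
  rw [← h3]
  exact ⟨_, hmem, by rw [map_add, map_smul, h1, h2]⟩

lemma axis_mem_of_mem {τ : ℝ} {w : Euc n} (hw : inner ℝ (axisVec n) w = 0)
    (hmem : τ • axisVec n + w ∈ K) : τ • axisVec n ∈ K := by
  have h1 : τ • axisVec n + -w ∈ K :=
    hK.mem_of_norm_eq hw (by rw [inner_neg_right, hw, neg_zero]) (norm_neg w).symm hmem
  have := hK.convex hmem h1 (a := 1 / 2) (b := 1 / 2) (by norm_num) (by norm_num) (by norm_num)
  convert this using 1
  module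

lemma exists_ball_subset : ∃ δ : ℝ, 0 < δ ∧ ∀ v : Euc n, ‖v‖ = 1 → δ • v ∈ K := by
  obtain ⟨δ, hδ, h⟩ := Metric.mem_nhds_iff.1 (mem_interior_iff_mem_nhds.1 hK.zero_mem_interior)
  refine ⟨δ / 2, by positivity, fun v hv => h ?_⟩
  rw [mem_ball_zero_iff, norm_smul, hv, mul_one, Real.norm_of_nonneg (by positivity)]
  linarith

lemma sectionRadius_neg (τ : ℝ) : sectionRadius K (-τ) = sectionRadius K τ := by
  have key : ∀ τ r : ℝ, τ • axisVec n + r • coordVec n 1 ∈ K →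
      (-τ) • axisVec n + r • coordVec n 1 ∈ K := by
    intro τ r h
    have h1 := hK.neg_mem h
    rw [neg_add, ← neg_smul] at h1
    refine hK.mem_of_norm_eq ?_ ?_ (norm_neg _) h1
    · rw [inner_neg_right, inner_smul_right, inner_axisVec_coordVec_one, mul_zero, neg_zero]
    · rw [inner_smul_right, inner_axisVec_coordVec_one, mul_zero]
  unfold sectionRadius
  congr 1
  ext r
  refine and_congr_right fun _ => ⟨fun h => ?_, key τ r⟩
  have := key _ _ h
  rwa [neg_neg] at this

lemma sectionRadius_abs (τ : ℝ) : sectionRadius K |τ| = sectionRadius K τ := by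
  rcases abs_choice τ with h | h <;> rw [h]
  exact hK.sectionRadius_neg τ

include hn

lemma bddAbove_sectionRadius (τ : ℝ) :
    BddAbove {r : ℝ | 0 ≤ r ∧ τ • axisVec n + r • coordVec n 1 ∈ K} :=
  (bddAbove_smul_mem hK.isCompact.isBounded _ (norm_coordVec_one hn)).mono fun _ h => h.2

lemma sectionRadius_mem {τ : ℝ} (h : τ • axisVec n ∈ K) :
    τ • axisVec n + sectionRadius K τ • coordVec n 1 ∈ K := by
  have hclosed : IsClosed {r : ℝ | 0 ≤ r ∧ τ • axisVec n + r • coordVec n 1 ∈ K} :=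
    (isClosed_le continuous_const continuous_id).inter
      (hK.isCompact.isClosed.preimage (by fun_prop))
  exact (hclosed.csSup_mem ⟨0, le_rfl, by simpa using h⟩ (hK.bddAbove_sectionRadius hn τ)).2

/-- A body of revolution is determined by its profile. -/
lemma mem_iff {τ : ℝ} {w : Euc n} (hw : inner ℝ (axisVec n) w = 0) :
    τ • axisVec n + w ∈ K ↔ τ • axisVec n ∈ K ∧ ‖w‖ ≤ sectionRadius K τ := by
  have hb := norm_coordVec_one hn
  have hrot : τ • axisVec n + w ∈ K ↔ τ • axisVec n + ‖w‖ • coordVec n 1 ∈ K := by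
    have h1 : inner ℝ (axisVec n) (‖w‖ • coordVec n 1) = 0 := by
      rw [inner_smul_right, inner_axisVec_coordVec_one, mul_zero]
    have h2 : ‖w‖ = ‖‖w‖ • coordVec n 1‖ := by rw [norm_smul, hb, norm_norm, mul_one]
    exact ⟨hK.mem_of_norm_eq hw h1 h2, hK.mem_of_norm_eq h1 hw h2.symm⟩
  constructor
  · intro h
    exact ⟨hK.axis_mem_of_mem hw h,
      le_csSup (hK.bddAbove_sectionRadius hn τ) ⟨norm_nonneg _, hrot.1 h⟩⟩
  · rintro ⟨h1, h2⟩
    rw [hrot]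
    have h3 := hK.sectionRadius_mem hn h1
    rcases (sectionRadius_nonneg K τ).eq_or_lt with h0 | h0
    · rw [show ‖w‖ = 0 from le_antisymm (h0 ▸ h2) (norm_nonneg _), zero_smul, add_zero]
      exact h1
    · have := hK.convex.add_smul_sub_mem h1 h3 (t := ‖w‖ / sectionRadius K τ)
        ⟨by positivity, by rw [div_le_one h0]; exact h2⟩
      rwa [add_sub_cancel_left, smul_smul, div_mul_cancel₀ _ h0.ne'] at this

lemma smul_axisVec_mem_iff {t : ℝ} : t • axisVec n ∈ K ↔ |t| ≤ halfLength K := by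
  have he := norm_axisVec hn
  have hbdd : BddAbove {t : ℝ | t • axisVec n ∈ K} := by
    simpa using bddAbove_smul_mem hK.isCompact.isBounded 0 he
  have hclosed : IsClosed {t : ℝ | t • axisVec n ∈ K} :=
    hK.isCompact.isClosed.preimage (by fun_prop)
  have h0 : (0 : ℝ) ∈ {t : ℝ | t • axisVec n ∈ K} := by
    simpa using hK.zero_mem
  have hmem : halfLength K • axisVec n ∈ K := hclosed.csSup_mem ⟨0, h0⟩ hbdd
  constructor
  · intro h
    refine abs_le'.2 ⟨le_csSup hbdd h, le_csSup hbdd ?_⟩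
    change (-t) • axisVec n ∈ K
    rw [neg_smul]
    exact hK.neg_mem h
  · intro h
    rcases (abs_nonneg t).trans h |>.eq_or_lt with h1 | h1
    · rw [show t = 0 from abs_nonpos_iff.1 (h1 ▸ h)]
      exact h0
    · have h2 := (abs_le.1 h)
      have h3 : (-halfLength K) • axisVec n ∈ K := by
        rw [neg_smul]; exact hK.neg_mem hmem
      have := hK.convex h3 hmem (a := (1 - t / halfLength K) / 2) (b := (1 + t / halfLength K) / 2)
        (by
          have : t / halfLength K ≤ 1 := by rw [div_le_one h1]; exact h2.2
          linarith)
        (by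
          have : -1 ≤ t / halfLength K := by rw [le_div_iff₀ h1]; linarith [h2.1]
          linarith) (by ring)
      rw [smul_smul, smul_smul, ← add_smul] at this
      convert this using 2
      field_simp
      ring

lemma mem_iff_abs {τ : ℝ} {w : Euc n} (hw : inner ℝ (axisVec n) w = 0) :
    τ • axisVec n + w ∈ K ↔ |τ| ≤ halfLength K ∧ ‖w‖ ≤ sectionRadius K τ := by
  rw [hK.mem_iff hn hw, hK.smul_axisVec_mem_iff hn]

lemma halfLength_pos : 0 < halfLength K := by
  obtain ⟨δ, hδ, h⟩ := hK.exists_ball_subset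
  have := (hK.smul_axisVec_mem_iff hn).1 (h _ (norm_axisVec hn))
  rw [abs_of_pos hδ] at this
  linarith

lemma le_sectionRadius {τ r : ℝ} (hr : 0 ≤ r) (h : τ • axisVec n + r • coordVec n 1 ∈ K) :
    r ≤ sectionRadius K τ :=
  le_csSup (hK.bddAbove_sectionRadius hn τ) ⟨hr, h⟩

lemma sectionRadius_zero_pos : 0 < sectionRadius K 0 := by
  obtain ⟨δ, hδ, h⟩ := hK.exists_ball_subset
  refine hδ.trans_le (hK.le_sectionRadius hn hδ.le ?_)
  rw [zero_smul, zero_add]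
  exact h _ (norm_coordVec_one hn)

lemma sectionRadius_eq_zero {τ : ℝ} (h : halfLength K < |τ|) : sectionRadius K τ = 0 := by
  have : {r : ℝ | 0 ≤ r ∧ τ • axisVec n + r • coordVec n 1 ∈ K} = ∅ := by
    refine eq_empty_of_forall_notMem fun r hr => ?_
    have h1 : inner ℝ (axisVec n) (r • coordVec n 1) = 0 := by
      rw [inner_smul_right, inner_axisVec_coordVec_one, mul_zero]
    exact absurd ((hK.mem_iff_abs hn h1).1 hr.2).1 (not_le.2 h)
  rw [sectionRadius, this, Real.sSup_empty]

lemma concaveOn_sectionRadius :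
    ConcaveOn ℝ (Icc (-halfLength K) (halfLength K)) (sectionRadius K) := by
  refine ⟨convex_Icc _ _, fun s hs t ht α β hα hβ hαβ => ?_⟩
  have h1 := hK.sectionRadius_mem hn ((hK.smul_axisVec_mem_iff hn).2 (abs_le.2 hs))
  have h2 := hK.sectionRadius_mem hn ((hK.smul_axisVec_mem_iff hn).2 (abs_le.2 ht))
  have h3 := hK.convex h1 h2 hα hβ hαβ
  have h4 := sectionRadius_nonneg K s
  have h5 := sectionRadius_nonneg K t
  refine hK.le_sectionRadius hn (by simp only [smul_eq_mul]; positivity) ?_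
  convert h3 using 1
  simp only [smul_eq_mul]
  module

lemma antitoneOn_sectionRadius : AntitoneOn (sectionRadius K) (Ici 0) := by
  intro s hs t ht hst
  have hs0 : 0 ≤ s := hs
  rcases le_or_gt t (halfLength K) with h | h
  · rcases (hs0.trans hst).eq_or_lt with h0 | h0
    · rw [show s = t by linarith]
    · have ht' : t ∈ Icc (-halfLength K) (halfLength K) := ⟨by linarith, h⟩
      have ht'' : -t ∈ Icc (-halfLength K) (halfLength K) := ⟨by linarith, by linarith⟩
      have := (hK.concaveOn_sectionRadius hn).2 ht'' ht' (show 0 ≤ (1 - s / t) / 2 by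
        have : s / t ≤ 1 := by rw [div_le_one h0]; exact hst
        linarith) (show 0 ≤ (1 + s / t) / 2 by positivity) (by ring)
      rw [hK.sectionRadius_neg] at this
      simp only [smul_eq_mul] at this
      rw [show (1 - s / t) / 2 * -t + (1 + s / t) / 2 * t = s by field_simp; ring] at this
      linarith
  · rw [hK.sectionRadius_eq_zero hn (h.trans_le (le_abs_self t))]
    exact sectionRadius_nonneg K s

lemma measurable_sectionRadius : Measurable (sectionRadius K) := by
  have h1 : Antitone fun t => sectionRadius K (max t 0) := fun s t hst =>
    hK.antitoneOn_sectionRadius hn (mem_Ici.2 (le_max_right s 0))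
      (mem_Ici.2 (le_max_right t 0)) (max_le_max_right 0 hst)
  have h2 : sectionRadius K = fun t => sectionRadius K (max |t| 0) := by
    ext t
    rw [max_eq_left (abs_nonneg t), hK.sectionRadius_abs]
  rw [h2]
  exact h1.measurable.comp measurable_norm

lemma isProfile : IsProfile (halfLength K)
    fun t => sectionRadius K t / sectionRadius K 0 where
  pos := hK.halfLength_pos hn
  concaveOn := by
    have h := ((hK.concaveOn_sectionRadius hn).subset
      (Icc_subset_Icc_left (by linarith [hK.halfLength_pos hn])) (convex_Icc 0 _)).smul
      (inv_nonneg.2 (hK.sectionRadius_zero_pos hn).le)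
    refine h.congr fun t _ => ?_
    simp [div_eq_inv_mul]
  map_zero := div_self (hK.sectionRadius_zero_pos hn).ne'
  nonneg := fun t _ => div_nonneg (sectionRadius_nonneg K t) (sectionRadius_nonneg K 0)
  antitoneOn := fun _ hs _ ht hst => div_le_div_of_nonneg_right
    (hK.antitoneOn_sectionRadius hn hs.1 ht.1 hst) (sectionRadius_nonneg K 0)

end IsSymmConvexBodyOfRevolution

/-! ### Volumes of central sections -/

/-- The volume of the unit ball of `ℝᵏ`. -/
noncomputable def unitBallVolume (k : ℕ) : ℝ := √Real.pi ^ k / Real.Gamma (k / 2 + 1)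

lemma unitBallVolume_pos (k : ℕ) : 0 < unitBallVolume k := by
  have := Real.Gamma_pos_of_pos (show (0 : ℝ) < k / 2 + 1 by positivity)
  unfold unitBallVolume
  have := Real.pi_pos
  positivity

lemma mul_sqrt_eq {R : ℝ} (hR : 0 ≤ R) (y : ℝ) : R * √y = √(R ^ 2 * y) := by
  rw [Real.sqrt_mul (sq_nonneg R), Real.sqrt_sq hR]

/-- The vectors orthogonal to two given ones. -/
lemma mem_orthogonal_span_pair {n : ℕ} {e u z : Euc n} :
    z ∈ (Submodule.span ℝ (range ![e, u]))ᗮ ↔ inner ℝ e z = 0 ∧ inner ℝ u z = 0 := by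
  rw [Matrix.range_cons, Matrix.range_cons, Matrix.range_empty, union_empty,
    Submodule.span_union, ← Submodule.inf_orthogonal, Submodule.mem_inf,
    Submodule.mem_orthogonal_singleton_iff_inner_right,
    Submodule.mem_orthogonal_singleton_iff_inner_right]

lemma finrank_orthogonal_span_pair {n : ℕ} {e u : Euc n} (he : ‖e‖ = 1) (hu : ‖u‖ = 1)
    (heu : inner ℝ e u = 0) :
    Module.finrank ℝ ((Submodule.span ℝ (range ![e, u]))ᗮ : Submodule ℝ (Euc n)) = n - 2 := by
  have ho : Orthonormal ℝ ![e, u] := by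
    rw [orthonormal_iff_ite]
    intro i j
    fin_cases i <;> fin_cases j <;>
      simp [he, hu, heu, real_inner_comm u e ▸ heu]
  have h1 := finrank_span_eq_card ho.linearIndependent
  have h2 := (Submodule.span ℝ (range ![e, u])).finrank_add_finrank_orthogonal
  rw [h1, finrank_euclideanSpace_fin, Fintype.card_fin] at h2
  omega

/-- A ball of codimension two, in a translate of the orthogonal complement of two vectors. -/
lemma hausdorffMeasure_translate_ball {n : ℕ} {e u : Euc n} (he : ‖e‖ = 1) (hu : ‖u‖ = 1)
    (heu : inner ℝ e u = 0) (p : Euc n) {r : ℝ} (hr : 0 ≤ r) :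
    (Measure.euclideanHausdorffMeasure (n - 2) : Measure (Euc n))
      {x | inner ℝ e (x - p) = 0 ∧ inner ℝ u (x - p) = 0 ∧ ‖x - p‖ ≤ r} =
      ENNReal.ofReal (unitBallVolume (n - 2) * r ^ (n - 2)) := by
  set W := (Submodule.span ℝ (range ![e, u]))ᗮ with hW
  have hfin : Module.finrank ℝ W = n - 2 := finrank_orthogonal_span_pair he hu heu
  have hiso : Isometry fun z : W => p + (z : Euc n) :=
    (isometry_add_left p).comp isometry_subtype_coe
  have hset : {x | inner ℝ e (x - p) = 0 ∧ inner ℝ u (x - p) = 0 ∧ ‖x - p‖ ≤ r} =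
      (fun z : W => p + (z : Euc n)) '' Metric.closedBall 0 r := by
    ext x
    simp only [mem_ofPred_eq, mem_image, mem_closedBall_zero_iff]
    constructor
    · rintro ⟨h1, h2, h3⟩
      exact ⟨⟨x - p, mem_orthogonal_span_pair.2 ⟨h1, h2⟩⟩, h3, by simp⟩
    · rintro ⟨z, hz, rfl⟩
      have := mem_orthogonal_span_pair.1 z.2
      rw [add_sub_cancel_left]
      exact ⟨this.1, this.2, hz⟩
  rw [hset, hiso.euclideanHausdorffMeasure_image, ← hfin,
    InnerProductSpace.euclideanHausdorffMeasure_eq_volume]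
  rcases Nat.eq_zero_or_pos (Module.finrank ℝ W) with h0 | h0
  · have hsub : Subsingleton W := Module.finrank_zero_iff.1 h0
    have : (volume : Measure W) = Measure.euclideanHausdorffMeasure 0 := by
      rw [← h0, InnerProductSpace.euclideanHausdorffMeasure_eq_volume]
    rw [this, h0]
    have hball : Metric.closedBall (0 : W) r = {0} := by
      ext z
      simp [Subsingleton.elim z 0, hr]
    rw [hball]
    simp [unitBallVolume]
  · have : Nontrivial W := Module.finrank_pos_iff.1 h0
    rw [InnerProductSpace.volume_closedBall, mul_comm, ENNReal.ofReal_mul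
      (unitBallVolume_pos (Module.finrank ℝ W)).le, ENNReal.ofReal_pow hr, unitBallVolume]

namespace IsSymmConvexBodyOfRevolution

variable {n : ℕ} {K : Set (Euc n)} (hK : IsSymmConvexBodyOfRevolution K) (hn : 3 ≤ n)

include hK hn

/-- The sections of `K` of codimension two, orthogonal to a meridian plane, are balls. -/
lemma hausdorffMeasure_codim_two {u : Euc n} (hu : ‖u‖ = 1) (heu : inner ℝ (axisVec n) u = 0)
    (τ y : ℝ) :
    (Measure.euclideanHausdorffMeasure (n - 2) : Measure (Euc n))
      (K ∩ {x | inner ℝ (axisVec n) (x - (τ • axisVec n + y • u)) = 0 ∧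
        inner ℝ u (x - (τ • axisVec n + y • u)) = 0}) =
      ENNReal.ofReal (unitBallVolume (n - 2) *
        √(sectionRadius K τ ^ 2 - y ^ 2) ^ (n - 2)) := by
  have hn2 : 2 ≤ n := by omega
  have he := norm_axisVec hn2
  have hR := sectionRadius_nonneg K τ
  set p := τ • axisVec n + y • u with hp
  have key : ∀ x, inner ℝ (axisVec n) (x - p) = 0 → inner ℝ u (x - p) = 0 →
      (x ∈ K ↔ |τ| ≤ halfLength K ∧ y ^ 2 + ‖x - p‖ ^ 2 ≤ sectionRadius K τ ^ 2) := by
    intro x h1 h2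
    have hx : x = τ • axisVec n + (y • u + (x - p)) := by rw [hp]; abel
    have horth : inner ℝ (axisVec n) (y • u + (x - p)) = 0 := by
      rw [inner_add_right, inner_smul_right, heu, h1, mul_zero, add_zero]
    have hnorm : ‖y • u + (x - p)‖ ^ 2 = y ^ 2 + ‖x - p‖ ^ 2 := by
      rw [norm_add_sq_real, inner_smul_left, h2, norm_smul, hu]
      simp
    conv_lhs => rw [hx]
    rw [hK.mem_iff_abs hn2 horth, ← hnorm, sq_le_sq₀ (norm_nonneg _) hR]
  by_cases h : |τ| ≤ halfLength K ∧ y ^ 2 ≤ sectionRadius K τ ^ 2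
  · have hset : K ∩ {x | inner ℝ (axisVec n) (x - p) = 0 ∧ inner ℝ u (x - p) = 0} =
        {x | inner ℝ (axisVec n) (x - p) = 0 ∧ inner ℝ u (x - p) = 0 ∧
          ‖x - p‖ ≤ √(sectionRadius K τ ^ 2 - y ^ 2)} := by
      ext x
      simp only [mem_inter_iff, mem_ofPred_eq]
      constructor
      · rintro ⟨h1, h2, h3⟩
        refine ⟨h2, h3, Real.le_sqrt_of_sq_le ?_⟩
        linarith [((key x h2 h3).1 h1).2]
      · rintro ⟨h1, h2, h3⟩
        refine ⟨(key x h1 h2).2 ⟨h.1, ?_⟩, h1, h2⟩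
        rw [Real.le_sqrt (norm_nonneg _) (by linarith [h.2])] at h3
        linarith
    rw [hset, hausdorffMeasure_translate_ball he hu heu p (Real.sqrt_nonneg _)]
  · have hset : K ∩ {x | inner ℝ (axisVec n) (x - p) = 0 ∧ inner ℝ u (x - p) = 0} = ∅ := by
      refine eq_empty_of_forall_notMem fun x hx => h ?_
      have := (key x hx.2.1 hx.2.2).1 hx.1
      exact ⟨this.1, by nlinarith [sq_nonneg ‖x - p‖]⟩
    have hle : sectionRadius K τ ^ 2 - y ^ 2 ≤ 0 := by
      by_cases h1 : |τ| ≤ halfLength K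
      · have : ¬ y ^ 2 ≤ sectionRadius K τ ^ 2 := fun h2 => h ⟨h1, h2⟩
        linarith [not_le.1 this]
      · rw [hK.sectionRadius_eq_zero hn2 (not_le.1 h1)]
        nlinarith [sq_nonneg y]
    rw [hset, measure_empty, Real.sqrt_eq_zero_of_nonpos hle, zero_pow (by omega), mul_zero,
      ENNReal.ofReal_zero]

/-- Slicing a central section by the planes orthogonal to its axial direction. -/
lemma hausdorffMeasure_section {u : Euc n} (hu : ‖u‖ = 1) (heu : inner ℝ (axisVec n) u = 0)
    {c s : ℝ} (hcs : c ^ 2 + s ^ 2 = 1) :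
    (Measure.euclideanHausdorffMeasure (n - 1) : Measure (Euc n))
      (K ∩ {x | inner ℝ (c • axisVec n + s • u) x = 0}) =
      ∫⁻ t : ℝ, ENNReal.ofReal (unitBallVolume (n - 2) *
        √(sectionRadius K (t * s) ^ 2 - (t * c) ^ 2) ^ (n - 2)) := by
  have he := norm_axisVec (show 2 ≤ n by omega)
  have hue : inner ℝ u (axisVec n) = 0 := by rw [real_inner_comm]; exact heu
  have hee : inner ℝ (axisVec n) (axisVec n) = (1 : ℝ) := by
    rw [real_inner_self_eq_norm_sq, he, one_pow]
  have huu : inner ℝ u u = (1 : ℝ) := by rw [real_inner_self_eq_norm_sq, hu, one_pow]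
  set d := c • axisVec n + s • u with hd
  set v := s • axisVec n - c • u with hv
  have hin : ∀ α β γ δ : ℝ, inner ℝ (α • axisVec n + β • u) (γ • axisVec n + δ • u) =
      α * γ + β * δ := by
    intro α β γ δ
    simp only [inner_add_left, inner_add_right, real_inner_smul_left, real_inner_smul_right,
      hee, huu, hue, heu]
    ring
  have hv' : v = s • axisVec n + (-c) • u := by rw [hv]; module
  have hdd : inner ℝ d d = (1 : ℝ) := by rw [hd, hin]; linarith
  have hvv : inner ℝ v v = (1 : ℝ) := by rw [hv', hin]; linarith
  have hdv : inner ℝ d v = (0 : ℝ) := by rw [hd, hv', hin]; ring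
  have hd0 : d ≠ 0 := by
    intro h
    rw [h, inner_zero_left] at hdd
    norm_num at hdd
  set U := (ℝ ∙ d)ᗮ with hU
  have hfin : Module.finrank ℝ U = n - 1 := by
    have h2 := (ℝ ∙ d).finrank_add_finrank_orthogonal
    rw [finrank_span_singleton hd0, finrank_euclideanSpace_fin] at h2
    change 1 + Module.finrank ℝ U = n at h2
    omega
  have hvU : v ∈ U := Submodule.mem_orthogonal_singleton_iff_inner_right.2 hdv
  have hset : K ∩ {x | inner ℝ d x = 0} = Subtype.val '' (Subtype.val ⁻¹' K : Set U) := by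
    ext x
    constructor
    · rintro ⟨h1, h2⟩
      exact ⟨⟨x, Submodule.mem_orthogonal_singleton_iff_inner_right.2 h2⟩, h1, rfl⟩
    · rintro ⟨z, hz, rfl⟩
      exact ⟨hz, Submodule.mem_orthogonal_singleton_iff_inner_right.1 z.2⟩
  have hmeas : MeasurableSet (Subtype.val ⁻¹' K : Set U) :=
    hK.isCompact.isClosed.measurableSet.preimage measurable_subtype_coe
  have hv1 : ‖(⟨v, hvU⟩ : U)‖ = 1 := by
    change ‖v‖ = 1
    rw [← sq_eq_sq₀ (norm_nonneg v) zero_le_one, ← real_inner_self_eq_norm_sq, hvv, one_pow]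
  have hv0 : (⟨v, hvU⟩ : U) ≠ 0 := norm_pos_iff.1 (by rw [hv1]; exact one_pos)
  rw [hset, isometry_subtype_coe.euclideanHausdorffMeasure_image, ← hfin,
    EuclideanGeometry.euclideanHausdorffMeasure_eq_lintegral (0 : U) hv0 hmeas, hfin]
  rw [← ofReal_norm, hv1, ENNReal.ofReal_one, one_mul, Nat.sub_sub]
  refine lintegral_congr fun t => ?_
  rw [← isometry_subtype_coe.euclideanHausdorffMeasure_image]
  have hneg : (t * c) ^ 2 = (-(t * c)) ^ 2 := by ring
  rw [hneg, ← hK.hausdorffMeasure_codim_two hn hu heu (t * s) (-(t * c))]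
  congr 1
  have htv : (t * s) • axisVec n + (-(t * c)) • u = t • v := by rw [hv]; module
  rw [htv]
  ext x
  simp only [mem_image, mem_inter_iff, mem_preimage, mem_ofPred_eq, SetLike.mem_coe,
    AffineSubspace.mem_mk']
  -- The pairs `d`, `v` and `e₁`, `u` span the same plane.
  have hde : ∀ z, inner ℝ d z = 0 ∧ inner ℝ v z = 0 ↔
      inner ℝ (axisVec n) z = 0 ∧ inner ℝ u z = 0 := by
    intro z
    rw [hd, hv]
    simp only [inner_add_left, inner_sub_left, real_inner_smul_left]
    constructor
    · rintro ⟨h1, h2⟩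
      constructor
      · linear_combination c * h1 + s * h2 - inner ℝ (axisVec n) z * hcs
      · linear_combination s * h1 - c * h2 - inner ℝ u z * hcs
    · rintro ⟨h1, h2⟩
      rw [h1, h2]
      constructor <;> ring
  rw [← hde]
  constructor
  · rintro ⟨z, ⟨h1, h2⟩, rfl⟩
    refine ⟨h1, ?_, ?_⟩
    · rw [inner_sub_right, inner_smul_right, hdv, mul_zero, sub_zero]
      exact Submodule.mem_orthogonal_singleton_iff_inner_right.1 z.2
    · have := Submodule.mem_orthogonal_singleton_iff_inner_right.1 h2
      simpa using this
  · rintro ⟨h1, h2, h3⟩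
    rw [inner_sub_right, inner_smul_right, hdv, mul_zero, sub_zero] at h2
    refine ⟨⟨x, Submodule.mem_orthogonal_singleton_iff_inner_right.2 h2⟩, ⟨h1, ?_⟩, rfl⟩
    refine Submodule.mem_orthogonal_singleton_iff_inner_right.2 ?_
    simpa using h3

lemma sectionVolume_eq_integral {u : Euc n} (hu : ‖u‖ = 1) (heu : inner ℝ (axisVec n) u = 0)
    {c s : ℝ} (hcs : c ^ 2 + s ^ 2 = 1) :
    sectionVolume K (c • axisVec n + s • u) = unitBallVolume (n - 2) *
      ∫ t : ℝ, √(sectionRadius K (t * s) ^ 2 - (t * c) ^ 2) ^ (n - 2) := by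
  have hm := hK.measurable_sectionRadius (show 2 ≤ n by omega)
  rw [sectionVolume, Measure.real, hK.hausdorffMeasure_section hn hu heu hcs,
    ← integral_const_mul, integral_eq_lintegral_of_nonneg_ae]
  · exact ae_of_all _ fun t => mul_nonneg (unitBallVolume_pos _).le (by positivity)
  · have : Measurable fun t : ℝ => unitBallVolume (n - 2) *
        √(sectionRadius K (t * s) ^ 2 - (t * c) ^ 2) ^ (n - 2) := by fun_prop
    exact this.aestronglyMeasurable

/-- The profile integrals of `K` are those of its normalized profile. -/
lemma integral_sqrt_sectionRadius (x : ℝ) :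
    ∫ t : ℝ, √(sectionRadius K t ^ 2 - (x * t) ^ 2) ^ (n - 2) =
      2 * (sectionRadius K 0 ^ (n - 2) * profileIntegral (halfLength K)
        (fun t => sectionRadius K t / sectionRadius K 0) (n - 2) (x / sectionRadius K 0)) := by
  have hn2 : 2 ≤ n := by omega
  have hR := hK.sectionRadius_zero_pos hn2
  have ha := hK.halfLength_pos hn2
  set R := sectionRadius K 0 with hRdef
  have h1 : ∀ t : ℝ, √(sectionRadius K t ^ 2 - (x * t) ^ 2) ^ (n - 2) =
      (fun t => √(sectionRadius K t ^ 2 - (x * t) ^ 2) ^ (n - 2)) |t| := by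
    intro t
    simp only
    rw [hK.sectionRadius_abs, mul_pow x |t|, sq_abs, ← mul_pow]
  rw [integral_congr_ae (ae_of_all _ h1)]
  rw [integral_comp_abs (f := fun t => √(sectionRadius K t ^ 2 - (x * t) ^ 2) ^ (n - 2)),
    setIntegral_eq_of_subset_of_forall_sdiff_eq_zero (s := Ioc 0 (halfLength K))
      measurableSet_Ioi Ioc_subset_Ioi_self, ← intervalIntegral.integral_of_le ha.le,
    profileIntegral, ← intervalIntegral.integral_const_mul (R ^ (n - 2))]
  · congr 1
    refine intervalIntegral.integral_congr fun t _ => ?_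
    rw [← mul_pow]
    congr 1
    rw [mul_sqrt_eq hR.le]
    congr 1
    field_simp
  · intro t ht
    have ht0 : 0 < t := ht.1
    have h2 : halfLength K < |t| := by
      rw [abs_of_pos ht0]
      by_contra! h
      exact ht.2 ⟨ht0, h⟩
    rw [hK.sectionRadius_eq_zero hn2 h2, Real.sqrt_eq_zero_of_nonpos
      (by nlinarith [sq_nonneg (x * t)]), zero_pow (by omega)]

lemma sectionVolume_of_pos {u : Euc n} (hu : ‖u‖ = 1) (heu : inner ℝ (axisVec n) u = 0)
    {c s : ℝ} (hcs : c ^ 2 + s ^ 2 = 1) (hs : 0 < s) :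
    sectionVolume K (c • axisVec n + s • u) * s = 2 * unitBallVolume (n - 2) *
      sectionRadius K 0 ^ (n - 2) * profileIntegral (halfLength K)
        (fun t => sectionRadius K t / sectionRadius K 0) (n - 2)
        (c / s / sectionRadius K 0) := by
  rw [hK.sectionVolume_eq_integral hn hu heu hcs]
  have h1 : ∀ t : ℝ, √(sectionRadius K (t * s) ^ 2 - (t * c) ^ 2) ^ (n - 2) =
      (fun t => √(sectionRadius K t ^ 2 - (c / s * t) ^ 2) ^ (n - 2)) (t * s) := by
    intro t
    simp only
    congr 4
    field_simp
  rw [integral_congr_ae (ae_of_all _ h1)]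
  rw [Measure.integral_comp_mul_right
    (fun t => √(sectionRadius K t ^ 2 - (c / s * t) ^ 2) ^ (n - 2)) s,
    hK.integral_sqrt_sectionRadius hn, abs_of_pos (inv_pos.2 hs), smul_eq_mul]
  field_simp

lemma sectionVolume_axis {c : ℝ} (hc : c ^ 2 = 1) :
    sectionVolume K (c • axisVec n) = 2 * unitBallVolume (n - 2) *
      sectionRadius K 0 ^ (n - 1) * ballRatio (n - 2) := by
  have hn2 : 2 ≤ n := by omega
  have hR := hK.sectionRadius_zero_pos hn2
  have h := hK.sectionVolume_eq_integral hn (norm_coordVec_one hn2) inner_axisVec_coordVec_one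
    (c := c) (s := 0) (by rw [hc]; norm_num)
  rw [zero_smul, add_zero] at h
  rw [h]
  set R := sectionRadius K 0 with hRdef
  have h1 : ∀ t : ℝ, √(sectionRadius K (t * 0) ^ 2 - (t * c) ^ 2) ^ (n - 2) =
      (fun t => √(R ^ 2 - t ^ 2) ^ (n - 2)) |t| := by
    intro t
    simp only
    rw [mul_zero, mul_pow, hc, mul_one, sq_abs]
  rw [integral_congr_ae (ae_of_all _ h1)]
  rw [integral_comp_abs (f := fun t => √(R ^ 2 - t ^ 2) ^ (n - 2)),
    setIntegral_eq_of_subset_of_forall_sdiff_eq_zero (s := Ioc 0 R)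
      measurableSet_Ioi Ioc_subset_Ioi_self, ← intervalIntegral.integral_of_le hR.le]
  · have h2 : ∫ t in (0 : ℝ)..R, √(R ^ 2 - t ^ 2) ^ (n - 2) =
        R * (R ^ (n - 2) * ballRatio (n - 2)) := by
      have h3 := intervalIntegral.mul_integral_comp_mul_left
        (f := fun t => √(R ^ 2 - t ^ 2) ^ (n - 2)) (a := 0) (b := 1) R
      rw [mul_zero, mul_one] at h3
      rw [← h3, ballRatio, profileIntegral, ← intervalIntegral.integral_const_mul (R ^ (n - 2))]
      congr 1
      refine intervalIntegral.integral_congr fun t _ => ?_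
      rw [← mul_pow]
      congr 1
      rw [mul_sqrt_eq hR.le]
      congr 1
      ring
    rw [h2, show n - 1 = n - 2 + 1 by omega, pow_succ]
    ring
  · intro t ht
    have ht0 : 0 < t := ht.1
    have h2 : R < t := by
      by_contra! h
      exact ht.2 ⟨ht0, h⟩
    rw [Real.sqrt_eq_zero_of_nonpos (by nlinarith), zero_pow (by omega)]

end IsSymmConvexBodyOfRevolution

/-! ### The gauge of the intersection body -/

lemma smul_mem_intersectionBody_iff {n : ℕ} {K : Set (Euc n)} {u : Euc n} (hu : ‖u‖ = 1) {r : ℝ}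
    (hr : 0 < r) : r • u ∈ intersectionBody K ↔ r ≤ sectionVolume K u := by
  constructor
  · rintro ⟨u', hu', r', hr', hle, h⟩
    have hrr : r = r' := by
      have := congrArg norm h
      rwa [norm_smul, norm_smul, hu, hu', mul_one, mul_one, Real.norm_of_nonneg hr.le,
        Real.norm_of_nonneg hr'] at this
    subst hrr
    rwa [smul_right_injective _ hr.ne' h]
  · intro h
    exact ⟨u, hu, r, hr.le, h, rfl⟩

lemma zero_mem_intersectionBody {n : ℕ} (hn : 2 ≤ n) (K : Set (Euc n)) :
    (0 : Euc n) ∈ intersectionBody K :=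
  ⟨axisVec n, norm_axisVec hn, 0, le_rfl, measureReal_nonneg, by simp⟩

/-- The gauge is determined by the radial function. -/
lemma gauge_intersectionBody {n : ℕ} {K : Set (Euc n)} {u : Euc n} (hu : ‖u‖ = 1) {r : ℝ}
    (hr : 0 < r) (hvol : 0 < sectionVolume K u) :
    gauge (intersectionBody K) (r • u) = r / sectionVolume K u := by
  rw [gauge_def']
  have : {t | t ∈ Ioi (0 : ℝ) ∧ t⁻¹ • r • u ∈ intersectionBody K} =
      Ici (r / sectionVolume K u) := by
    ext t
    constructor
    · rintro ⟨ht, h⟩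
      have ht0 : 0 < t := ht
      rw [smul_smul, smul_mem_intersectionBody_iff hu (by positivity), inv_mul_le_iff₀ ht0] at h
      rw [mem_Ici, div_le_iff₀ hvol]
      exact h
    · intro ht
      have ht0 : 0 < t := (div_pos hr hvol).trans_le ht
      refine ⟨ht0, ?_⟩
      rw [smul_smul, smul_mem_intersectionBody_iff hu (by positivity), inv_mul_le_iff₀ ht0]
      rw [mem_Ici, div_le_iff₀ hvol] at ht
      exact ht
  rw [this, csInf_Ici]

lemma radialFun_intersectionBody {n : ℕ} (hn : 2 ≤ n) (K : Set (Euc n)) {u : Euc n}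
    (hu : ‖u‖ = 1) : radialFun (intersectionBody K) u = sectionVolume K u := by
  have hvol : 0 ≤ sectionVolume K u := measureReal_nonneg
  have : {t : ℝ | 0 ≤ t ∧ t • u ∈ intersectionBody K} = Icc 0 (sectionVolume K u) := by
    ext t
    refine and_congr_right fun ht => ?_
    rcases ht.eq_or_lt with rfl | ht0
    · simp [hvol, zero_mem_intersectionBody hn K]
    · exact smul_mem_intersectionBody_iff hu ht0
  rw [radialFun, this, csSup_Icc hvol]

lemma profileIntegral_neg (a : ℝ) (g : ℝ → ℝ) (k : ℕ) (x : ℝ) :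
    profileIntegral a g k (-x) = profileIntegral a g k x := by
  simp [profileIntegral]

namespace IsSymmConvexBodyOfRevolution

variable {n : ℕ} {K : Set (Euc n)} (hK : IsSymmConvexBodyOfRevolution K) (hn : 4 ≤ n)

include hK hn

lemma sectionVolume_pos {u : Euc n} (hu : ‖u‖ = 1) : 0 < sectionVolume K u := by
  have hn2 : 2 ≤ n := by omega
  have he := norm_axisVec hn2
  have hR := hK.sectionRadius_zero_pos hn2
  set c : ℝ := inner ℝ (axisVec n) u with hc
  set w := u - c • axisVec n with hw
  have hwe : inner ℝ (axisVec n) w = 0 := by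
    rw [hw, inner_sub_right, inner_smul_right, real_inner_self_eq_norm_sq, he, ← hc]; ring
  have huw : u = c • axisVec n + w := by rw [hw]; abel
  have hnorm : c ^ 2 + ‖w‖ ^ 2 = 1 := by
    have h1 : ‖c • axisVec n + w‖ ^ 2 = c ^ 2 + ‖w‖ ^ 2 := by
      rw [norm_add_sq_real, inner_smul_left, hwe, norm_smul, he]
      simp
    rw [← h1, ← huw, hu, one_pow]
  by_cases hw0 : w = 0
  · rw [hw0, norm_zero, zero_pow two_ne_zero, add_zero] at hnorm
    rw [huw, hw0, add_zero, hK.sectionVolume_axis (by omega) hnorm]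
    have := unitBallVolume_pos (n - 2)
    have := ballRatio_pos (k := n - 2) (by omega)
    positivity
  · have hN : 0 < ‖w‖ := norm_pos_iff.2 hw0
    have h := hK.sectionVolume_of_pos (by omega) (u := ‖w‖⁻¹ • w)
      (by rw [norm_smul, norm_inv, norm_norm, inv_mul_cancel₀ hN.ne'])
      (by rw [inner_smul_right, hwe, mul_zero]) hnorm hN
    rw [smul_smul, mul_inv_cancel₀ hN.ne', one_smul, ← huw] at h
    refine pos_of_mul_pos_left (b := ‖w‖) ?_ hN.le
    rw [h]
    have := unitBallVolume_pos (n - 2)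
    have := (hK.isProfile hn2).profileIntegral_pos (k := n - 2) (by omega)
      (c / ‖w‖ / sectionRadius K 0)
    positivity

/-- The gauge of the intersection body in terms of the section integrals of the profile. -/
theorem isAxialGauge_intersectionBody : IsAxialGauge (intersectionBody K)
    (2 * unitBallVolume (n - 2) * sectionRadius K 0 ^ (n - 1) * ballRatio (n - 2))
    (fun x => (2 * unitBallVolume (n - 2) * sectionRadius K 0 ^ (n - 2) *
      profileIntegral (halfLength K) (fun t => sectionRadius K t / sectionRadius K 0) (n - 2)
        (x / sectionRadius K 0))⁻¹) := by
  have hn2 : 2 ≤ n := by omega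
  have he := norm_axisVec hn2
  have hR := hK.sectionRadius_zero_pos hn2
  have hω := unitBallVolume_pos (n - 2)
  have hJ := ballRatio_pos (k := n - 2) (by omega)
  have hΨ := fun x => (hK.isProfile hn2).profileIntegral_pos (k := n - 2) (by omega) x
  have hconv := (hK.isProfile hn2).convexOn_inv_profileIntegral (k := n - 2) (by omega)
  refine ⟨hn2, by positivity, fun x => ?_, fun x => ?_, ?_, fun v => ?_, fun σ => ?_,
    fun σ w hw0 hwe => ?_⟩
  · have := hΨ (x / sectionRadius K 0)
    positivity
  · rw [neg_div, profileIntegral_neg]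
  · refine ⟨convex_univ, fun x _ y _ α β hα hβ hαβ => ?_⟩
    have h := hconv.2 (mem_univ (x / sectionRadius K 0)) (mem_univ (y / sectionRadius K 0))
      hα hβ hαβ
    simp only [smul_eq_mul] at h ⊢
    rw [show α * (x / sectionRadius K 0) + β * (y / sectionRadius K 0) =
      (α * x + β * y) / sectionRadius K 0 by ring] at h
    simp only [mul_inv (2 * unitBallVolume (n - 2) * sectionRadius K 0 ^ (n - 2))]
    have h2 : 0 ≤ (2 * unitBallVolume (n - 2) * sectionRadius K 0 ^ (n - 2))⁻¹ := by positivity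
    refine (mul_le_mul_of_nonneg_left h h2).trans (le_of_eq ?_)
    ring
  · by_cases hv : v = 0
    · simp [hv, zero_mem_intersectionBody hn2 K]
    · have hN : 0 < ‖v‖ := norm_pos_iff.2 hv
      have hu : ‖‖v‖⁻¹ • v‖ = 1 := by
        rw [norm_smul, norm_inv, norm_norm, inv_mul_cancel₀ hN.ne']
      have hvol := hK.sectionVolume_pos hn hu
      have hvu : v = ‖v‖ • ‖v‖⁻¹ • v := by
        rw [smul_smul, mul_inv_cancel₀ hN.ne', one_smul]
      rw [hvu, gauge_intersectionBody hu hN hvol, smul_mem_intersectionBody_iff hu hN,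
        div_le_one hvol]
  · have hax : ∀ c : ℝ, c ^ 2 = 1 → ∀ r : ℝ, 0 < r →
        gauge (intersectionBody K) (r • c • axisVec n) = r / (2 * unitBallVolume (n - 2) *
          sectionRadius K 0 ^ (n - 1) * ballRatio (n - 2)) := by
      intro c hc r hr
      have hu : ‖c • axisVec n‖ = 1 := by
        rw [norm_smul, he, mul_one, Real.norm_eq_abs, ← sq_eq_sq₀ (abs_nonneg c) zero_le_one,
          sq_abs, hc, one_pow]
      rw [gauge_intersectionBody hu hr (hK.sectionVolume_pos hn hu),
        hK.sectionVolume_axis (by omega) hc]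
    rcases lt_trichotomy σ 0 with h | h | h
    · have := hax (-1) (by norm_num) (-σ) (by linarith)
      rw [abs_of_neg h, ← this, smul_smul]
      congr 2
      ring
    · simp [h]
    · have := hax 1 (by norm_num) σ h
      rw [abs_of_pos h, ← this, one_smul]
  · have hw : 0 < ‖w‖ := norm_pos_iff.2 hw0
    set v := σ • axisVec n + w with hv
    have hnorm : ‖v‖ ^ 2 = σ ^ 2 + ‖w‖ ^ 2 := by
      rw [hv, norm_add_sq_real, inner_smul_left, hwe, norm_smul, he]
      simp
    have hN : 0 < ‖v‖ := by
      refine lt_of_le_of_ne (norm_nonneg v) fun h => ?_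
      rw [← h] at hnorm
      nlinarith [sq_nonneg σ]
    have hcs : (σ / ‖v‖) ^ 2 + (‖w‖ / ‖v‖) ^ 2 = 1 := by
      rw [div_pow, div_pow, ← add_div, ← hnorm, div_self (by positivity)]
    have h := hK.sectionVolume_of_pos (by omega) (u := ‖w‖⁻¹ • w)
      (by rw [norm_smul, norm_inv, norm_norm, inv_mul_cancel₀ hw.ne'])
      (by rw [inner_smul_right, hwe, mul_zero]) hcs (by positivity)
    have hu : (σ / ‖v‖) • axisVec n + (‖w‖ / ‖v‖) • ‖w‖⁻¹ • w = ‖v‖⁻¹ • v := by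
      rw [hv, smul_add, smul_smul, smul_smul]
      congr 2
      · ring
      · field_simp
    rw [hu, div_div_div_cancel_right₀ hN.ne'] at h
    have hu1 : ‖‖v‖⁻¹ • v‖ = 1 := by
      rw [norm_smul, norm_inv, norm_norm, inv_mul_cancel₀ hN.ne']
    have hvol := hK.sectionVolume_pos hn hu1
    have hvu : v = ‖v‖ • ‖v‖⁻¹ • v := by rw [smul_smul, mul_inv_cancel₀ hN.ne', one_smul]
    conv_lhs => rw [hvu, gauge_intersectionBody hu1 hN hvol]
    rw [← h]
    field_simp

lemma equatorialProfile_intersectionBody (x : ℝ) :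
    equatorialProfile (intersectionBody K) x = 2 * unitBallVolume (n - 2) *
      sectionRadius K 0 ^ (n - 2) * profileIntegral (halfLength K)
        (fun t => sectionRadius K t / sectionRadius K 0) (n - 2) (x / sectionRadius K 0) := by
  have hn2 : 2 ≤ n := by omega
  have hs : 0 < Real.cos (Real.arctan x) := Real.cos_arctan_pos x
  have hcs : Real.sin (Real.arctan x) ^ 2 + Real.cos (Real.arctan x) ^ 2 = 1 :=
    Real.sin_sq_add_cos_sq _
  have hu : ‖Real.sin (Real.arctan x) • coordVec n 0 +
      Real.cos (Real.arctan x) • coordVec n 1‖ = 1 := by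
    have h1 : ‖Real.sin (Real.arctan x) • axisVec n +
        Real.cos (Real.arctan x) • coordVec n 1‖ ^ 2 = 1 := by
      rw [norm_add_sq_real, inner_smul_left, inner_smul_right, inner_axisVec_coordVec_one,
        norm_smul, norm_smul, norm_axisVec hn2, norm_coordVec_one hn2]
      simp
    exact (sq_eq_sq₀ (norm_nonneg _) zero_le_one).1 (by rw [h1, one_pow])
  rw [equatorialProfile, radialAngle, Real.cos_pi_div_two_sub, Real.sin_pi_div_two_sub,
    radialFun_intersectionBody hn2 K hu, abs_of_pos hs,
    hK.sectionVolume_of_pos (by omega) (norm_coordVec_one hn2) inner_axisVec_coordVec_one hcs hs,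
    ← Real.tan_eq_sin_div_cos, Real.tan_arctan]

/-- The expansion of the modulus at short chords. -/
theorem exists_modulus_expansion_small : ∃ c : ℝ, 4 / 27 ≤ c ∧ c ≤ 240000 ∧
    ∀ ε, 0 < ε → ε ≤ 1 / 10 ^ 7 →
      |equatorialModulus (intersectionBody K) ε - c * ε ^ 2| ≤ 10 ^ 12 * ε ^ 3 := by
  have hn2 : 2 ≤ n := by omega
  have hL := hK.isAxialGauge_intersectionBody hn
  have hR := hK.sectionRadius_zero_pos hn2
  have hω := unitBallVolume_pos (n - 2)
  have hJ := ballRatio_pos (k := n - 2) (by omega)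
  have hΨ := fun x => (hK.isProfile hn2).profileIntegral_pos (k := n - 2) (by omega) x
  obtain ⟨c, hc1, hc2, h⟩ := (hK.isProfile hn2).exists_least_chord (k := n - 2) (by omega)
  refine ⟨c, hc1, hc2, fun ε hε hε1 => ?_⟩
  obtain ⟨x, hx, hxeq, hmin, hbound⟩ := h ε hε (hε1.trans (by norm_num))
  have hpow : sectionRadius K 0 ^ (n - 1) = sectionRadius K 0 ^ (n - 2) * sectionRadius K 0 := by
    rw [← pow_succ]; congr 1; omega
  have hratio : (2 * unitBallVolume (n - 2) * sectionRadius K 0 ^ (n - 2) *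
      profileIntegral (halfLength K) (fun t => sectionRadius K t / sectionRadius K 0) (n - 2)
        (0 / sectionRadius K 0))⁻¹ / (2 * unitBallVolume (n - 2) * sectionRadius K 0 ^ (n - 2) *
      profileIntegral (halfLength K) (fun t => sectionRadius K t / sectionRadius K 0) (n - 2)
        (sectionRadius K 0 * x / sectionRadius K 0))⁻¹ =
      profileIntegral (halfLength K) (fun t => sectionRadius K t / sectionRadius K 0) (n - 2) x /
      profileIntegral (halfLength K) (fun t => sectionRadius K t / sectionRadius K 0) (n - 2) 0 := by
    rw [zero_div, mul_div_cancel_left₀ _ hR.ne']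
    have := hΨ x
    have := hΨ 0
    field_simp
  have hmod := hL.modulus_eq (x := sectionRadius K 0 * x) hε (by positivity) ?_ ?_ ?_
  · rw [hmod, hratio]
    exact hbound
  · rw [mul_div_cancel_left₀ _ hR.ne', hpow]
    have h1 := hΨ x
    field_simp
    linarith
  · intro y hy hy2
    have h1 := hΨ (y / sectionRadius K 0)
    have h2 : x ≤ y / sectionRadius K 0 := by
      refine hmin _ (by positivity) ?_
      rw [hpow] at hy2
      have e : ε * (2 * unitBallVolume (n - 2) *
          (sectionRadius K 0 ^ (n - 2) * sectionRadius K 0) * ballRatio (n - 2)) *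
          (2 * unitBallVolume (n - 2) * sectionRadius K 0 ^ (n - 2) *
            profileIntegral (halfLength K) (fun t => sectionRadius K t / sectionRadius K 0) (n - 2)
              (y / sectionRadius K 0))⁻¹ = ε * ballRatio (n - 2) * sectionRadius K 0 /
            profileIntegral (halfLength K) (fun t => sectionRadius K t / sectionRadius K 0) (n - 2)
              (y / sectionRadius K 0) := by
        field_simp
      rw [e, div_le_iff₀ h1] at hy2
      rw [div_mul_eq_mul_div, le_div_iff₀ hR]
      exact hy2
    rw [le_div_iff₀ hR] at h2
    linarith
  · rw [hratio]
    have h1 := (abs_le.1 hbound).2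
    have h2 : c * ε ^ 2 ≤ ε / 2 := by nlinarith
    have h3 : ε ^ 2 ≤ (1 / 10 ^ 7) ^ 2 := by gcongr
    have h4 : 10 ^ 12 * ε ^ 3 ≤ ε / 2 := by
      calc 10 ^ 12 * ε ^ 3 = ε * (10 ^ 12 * ε ^ 2) := by ring
        _ ≤ ε * (10 ^ 12 * (1 / 10 ^ 7) ^ 2) := by gcongr
        _ ≤ ε / 2 := by norm_num; linarith
    linarith

/-- Long chords contribute nothing new, since the modulus lies between `0` and `1`. -/
theorem exists_modulus_expansion : ∃ c : ℝ, 4 / 27 ≤ c ∧ c ≤ 240000 ∧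
    ∀ ε, 0 < ε → ε ≤ 1 →
      |equatorialModulus (intersectionBody K) ε - c * ε ^ 2| ≤ 10 ^ 27 * ε ^ 3 := by
  have hL := hK.isAxialGauge_intersectionBody hn
  obtain ⟨c, hc1, hc2, h⟩ := hK.exists_modulus_expansion_small hn
  refine ⟨c, hc1, hc2, fun ε hε hε1 => ?_⟩
  rcases le_total ε (1 / 10 ^ 7) with h1 | h1
  · exact (h ε hε h1).trans
      (mul_le_mul_of_nonneg_right (by norm_num) (by positivity))
  · have h2 := hL.modulus_le_one hε.le hε1
    have h3 := hL.modulus_nonneg hε.le hε1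
    have h4 : (1 / 10 ^ 7) ^ 3 ≤ ε ^ 3 := by gcongr
    have h5 : c * ε ^ 2 ≤ 240000 * 1 := by
      have : ε ^ 2 ≤ 1 := pow_le_one₀ hε.le hε1
      gcongr
    have h6 : 0 ≤ c * ε ^ 2 := by positivity
    have h7 : (240001 : ℝ) ≤ 10 ^ 27 * ε ^ 3 := by
      refine le_trans ?_ (mul_le_mul_of_nonneg_left h4 (by positivity))
      norm_num
    rw [abs_le]
    constructor <;> linarith

lemma hasEquatorialPowerType_intersectionBody :
    HasEquatorialPowerType 2 (intersectionBody K) := by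
  have hn2 : 2 ≤ n := by omega
  have hk : 2 ≤ n - 2 := by omega
  have hR := hK.sectionRadius_zero_pos hn2
  have hω := unitBallVolume_pos (n - 2)
  have hg := hK.isProfile hn2
  have hV := hg.profileIntegral_pos (k := n - 2) (by omega) 0
  have hprof := hK.equatorialProfile_intersectionBody hn
  obtain ⟨q, hq1, -, hexp⟩ := hg.exists_expansion hk
  set Ψ := profileIntegral (halfLength K) (fun t => sectionRadius K t / sectionRadius K 0) (n - 2)
    with hΨ
  set R := sectionRadius K 0
  set C := 2 * unitBallVolume (n - 2) * R ^ (n - 2) with hC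
  have hC0 : 0 < C := by positivity
  have hq0 : 0 < q := by linarith
  have hμ : 0 < √((n - 2 : ℕ) / 2 : ℝ) := by
    have : (2 : ℝ) ≤ (n - 2 : ℕ) := by exact_mod_cast hk
    positivity
  set κ := √((n - 2 : ℕ) / 2 : ℝ) * Ψ 0 / R with hκ
  have hκ0 : 0 < κ := by positivity
  refine ⟨C * Ψ 0 * (q * κ ^ 2) / 4, 2 * (C * Ψ 0 * (q * κ ^ 2)), 1 / (360000 * κ),
    by positivity, by positivity, by positivity, fun x hx0 hx1 => ?_⟩
  have habs : Ψ (x / R) = Ψ (|x| / R) := by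
    rcases abs_choice x with h | h <;> rw [h]
    rw [neg_div, hΨ, profileIntegral_neg]
  obtain ⟨h1, h2⟩ := hexp (|x| / R) (by positivity)
  have eX : √((n - 2 : ℕ) / 2 : ℝ) * (|x| / R) * Ψ 0 = κ * |x| := by rw [hκ]; ring
  rw [eX] at h1 h2
  rw [le_div_iff₀ (by positivity)] at hx1
  have hx2 : 60000 * (κ * |x|) ^ 3 ≤ q / 2 * (κ * |x|) ^ 2 := by
    have h3 : 60000 * (κ * |x|) ≤ q / 2 := by linarith
    calc 60000 * (κ * |x|) ^ 3 = 60000 * (κ * |x|) * (κ * |x|) ^ 2 := by ring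
      _ ≤ q / 2 * (κ * |x|) ^ 2 := by gcongr
  have hpos : 0 < q * (κ * |x|) ^ 2 := by positivity
  have hdiff : |equatorialProfile (intersectionBody K) x -
      equatorialProfile (intersectionBody K) 0| = C * Ψ 0 * (1 - Ψ (|x| / R) / Ψ 0) := by
    rw [hprof, hprof, zero_div, habs, abs_sub_comm, ← mul_sub, abs_of_nonneg]
    · field_simp
    · refine mul_nonneg hC0.le ?_
      have : Ψ (|x| / R) / Ψ 0 ≤ 1 := by linarith
      rw [div_le_one hV] at this
      linarith
  have hCV : 0 < C * Ψ 0 := by positivity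
  rw [hdiff, Real.rpow_two]
  have hxx : 0 < |x| ^ 2 := by positivity
  constructor
  · rw [lt_div_iff₀ hxx]
    have h3 : q * (κ * |x|) ^ 2 / 4 < 1 - Ψ (|x| / R) / Ψ 0 := by linarith
    calc C * Ψ 0 * (q * κ ^ 2) / 4 * |x| ^ 2 = C * Ψ 0 * (q * (κ * |x|) ^ 2 / 4) := by ring
      _ < _ := by gcongr
  · rw [div_lt_iff₀ hxx]
    have h3 : 1 - Ψ (|x| / R) / Ψ 0 < 2 * (q * (κ * |x|) ^ 2) := by linarith
    calc C * Ψ 0 * (1 - Ψ (|x| / R) / Ψ 0) < C * Ψ 0 * (2 * (q * (κ * |x|) ^ 2)) := by gcongr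
      _ = _ := by ring

/-- The lower bound of the modulus at the length where the expansion is still effective carries
over to longer chords by monotonicity. -/
lemma modulus_bounds : ∀ ε, 0 < ε → ε ≤ 1 →
    (1 / 10 ^ 60 : ℝ) * ε ^ 2 < equatorialModulus (intersectionBody K) ε ∧
    equatorialModulus (intersectionBody K) ε < 10 ^ 28 * ε ^ 2 := by
  have hL := hK.isAxialGauge_intersectionBody hn
  obtain ⟨c, hc1, hc2, h⟩ := hK.exists_modulus_expansion hn
  have hsmall : ∀ ε, 0 < ε → ε ≤ 1 / 10 ^ 29 →
      1 / 10 * ε ^ 2 < equatorialModulus (intersectionBody K) ε := by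
    intro ε hε hε1
    have h1 := (abs_le.1 (h ε hε (hε1.trans (by norm_num)))).1
    have h2 : 10 ^ 27 * ε ^ 3 ≤ 1 / 100 * ε ^ 2 := by
      calc 10 ^ 27 * ε ^ 3 = 10 ^ 27 * ε * ε ^ 2 := by ring
        _ ≤ 10 ^ 27 * (1 / 10 ^ 29) * ε ^ 2 := by gcongr
        _ = 1 / 100 * ε ^ 2 := by norm_num
    have h3 : 4 / 27 * ε ^ 2 ≤ c * ε ^ 2 := by gcongr
    have h4 : 0 < ε ^ 2 := by positivity
    linarith
  intro ε hε hε1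
  have hε2 : 0 < ε ^ 2 := by positivity
  have hle : ε ^ 2 ≤ 1 := pow_le_one₀ hε.le hε1
  constructor
  · rcases le_total ε (1 / 10 ^ 29) with h1 | h1
    · refine lt_trans ?_ (hsmall ε hε h1)
      gcongr
      norm_num
    · refine lt_of_lt_of_le ?_ (hL.modulus_mono (by norm_num) h1 hε1)
      refine lt_of_le_of_lt ?_ (hsmall (1 / 10 ^ 29) (by norm_num) le_rfl)
      calc (1 / 10 ^ 60 : ℝ) * ε ^ 2 ≤ 1 / 10 ^ 60 * 1 := by gcongr
        _ ≤ _ := by norm_num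
  · have h1 := (abs_le.1 (h ε hε hε1)).2
    have h2 : ε ^ 3 ≤ ε ^ 2 := pow_le_pow_of_le_one hε.le hε1 (by norm_num)
    have h3 : c * ε ^ 2 ≤ 240000 * ε ^ 2 := by gcongr
    norm_num at h1 ⊢
    linarith

end IsSymmConvexBodyOfRevolution

end BodyOfRevolution

theorem mainTheorem1 :
    BodyOfRevolution.HasUniformEquatorialPowerType 2 BodyOfRevolution.intersectionBodyClass ∧
    ∃ c₁ c₂ M : ℝ, 0 < c₁ ∧ 0 < c₂ ∧ 0 < M ∧
      ∀ (n : ℕ), 4 ≤ n → ∀ K : Set (BodyOfRevolution.Euc n),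
        BodyOfRevolution.IsSymmConvexBodyOfRevolution K →
          ∃ c : ℝ, c₁ ≤ c ∧ c ≤ c₂ ∧ ∀ ε : ℝ, 0 < ε → ε ≤ 1 →
            |BodyOfRevolution.equatorialModulus (BodyOfRevolution.intersectionBody K) ε
              - c * ε ^ 2| ≤ M * ε ^ 3 := by
  refine ⟨⟨?_, 1 / 10 ^ 60, 10 ^ 28, by norm_num, by norm_num, ?_⟩,
    4 / 27, 240000, 10 ^ 27, by norm_num, by norm_num, by norm_num,
    fun n hn K hK => hK.exists_modulus_expansion hn⟩
  · rintro L ⟨hn, K, hK, hL⟩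
    rw [hL]
    exact hK.hasEquatorialPowerType_intersectionBody hn
  · rintro L ⟨hn, K, hK, hL⟩ ε hε hε1
    have hε2 : 0 < ε ^ 2 := by positivity
    rw [hL, Real.rpow_two, lt_div_iff₀ hε2, div_lt_iff₀ hε2]
    exact hK.modulus_bounds hn ε hε hε1
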